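/- Let $n=n_1+n_2$ and write $(x,y)\in\mathbb R^{n_1}\times\mathbb R^{n_2}$. A map is called Hölder on a set if every point of the set has a neighbourhood in it on which the map is Hölder continuous for some positive exponent. A \emph{Hölder foliation chart with smooth leaves} is a homeomorphism $\Gamma$ from an open set $O\subset\mathbb R^{n_1}\times\mathbb R^{n_2}$ onto an open set $\Gamma(O)\subset\mathbb R^{n}$ such that $\Gamma$ and $\Gamma^{-1}$ are Hölder, $\Gamma$ has $y$-derivatives of all orders, these are Hölder in $(x,y)$, and $\Gamma(x,\cdot)$ is an immersion for every fixed $x$. A \emph{Hölder foliation $\mathcal F$ with smooth leaves} on an open set $M\subset\mathbb R^n$ is given by a family of such charts whose images cover $M$ and whose transition maps locally map plaques $\{x=\mathrm{const}\}$ into plaques. It is \emph{strongly absolutely continuous} if for each chart $\Gamma$ there is a continuous $J>0$ on $O$ having $y$-derivatives of all orders, all of them (including $J$ itself) Hölder in $(x,y)$, such that $\int \varphi(z)\,dz=\int_O \varphi(\Gamma(x,y))J(x,y)\,dx\,dy$ for all continuous $\varphi$ with compact support in $\Gamma(O)$. For a chart $\Gamma$ let $V_j$ ($1\le j\le n_2$)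 be the push-forward of $\partial/\partial y_j$ under $\Gamma$. For $\alpha>0$ let $C^{\alpha}$ be the space of $\alpha$-Hölder complex functions with compact support in $\Gamma(O)$, and let $C^{\alpha,k}_{\mathcal F}\subset C^\alpha$ be the subspace of functions whose derivatives $V_{j_1}\cdots V_{j_l}h$ of all orders $l\le k$ exist and are $\alpha$-Hölder. Let $(C^\alpha)^*$ be the space of linear functionals on $C^\alpha$ that are, for each compact $K\subset\Gamma(O)$, bounded in the $\alpha$-Hölder norm on the functions supported in $K$. Derivatives of a distribution $D$ along $\mathcal F$ are defined by $\langle V_jD,h\rangle=-\langle D,V_jh\rangle$, so that $V_{j_1}\cdots V_{j_k}D$ is a functional on $C^{\alpha,k}_{\mathcal F}$; it is said to belong to $(C^\alpha)^*$ if it extends from $C^{\alpha,k}_{\mathcal F}$ to an element of $(C^\alpha)^*$. For $u\in L^1(M)$, $z_0\in M$ and $\zeta_0\in\mathbb R^n\setminus\{0\}$, the pair $(z_0,\zeta_0)$ is \emph{not} in the wave front set $WF(u)$ if there are an open set $U$ with $z_0\in U\subset M$ and an open cone $Z\subset\mathbb R^n\setminus\{0\}$ containing $\zeta_0$ such that for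 every integer $N>0$ and every $C^\infty$ function $\chi$ on $\mathbb R^n$ with support in $U$ there is a constant $C$ with $$\Bigl|\int u(z)\chi(z)e^{-iz\cdot\zeta}\,dz\Bigr|\le C|\zeta|^{-N}\qquad\text{for all }\zeta\in Z,\ |\zeta|>1 .$$ \textbf{Theorem.} Let $\mathcal F$ be a strongly absolutely continuous Hölder foliation with smooth leaves on an open set $M\subset\mathbb R^n$, let $u\in L^1(M)$, and let $D$ be the distribution given by integration against $u$. Assume that in every chart of $\mathcal F$ the derivative $V_{j_1}\cdots V_{j_k}D$ belongs to $(C^{\alpha})^*$ for all $k\ge 0$, all $j_1,\dots,j_k$ and all $\alpha>0$. If $z_0\in M$ and the covector $\zeta_0\ne0$ at $z_0$ is not conormal to $\mathcal F$ (that is, it does not annihilate the tangent space at $z_0$ of the leaf through $z_0$), then $(z_0,\zeta_0)\notin WF(u)$. -/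

import Mathlib

open MeasureTheory Topology Set
open scoped NNReal ContDiff

/-- `ℝⁿ` with its Euclidean norm, inner product and Lebesgue measure. -/
abbrev Euc (n : ℕ) : Type := EuclideanSpace ℝ (Fin n)

/-! ### Hölder foliations with smooth leaves -/

/-- `f` is (locally) Hölder on `s`: every point of `s` has a neighbourhood in `s` on which `f` is
Hölder continuous for some positive exponent. -/
def IsHolderOn {A B : Type*} [PseudoEMetricSpace A] [PseudoEMetricSpace B]
    (f : A → B) (s : Set A) : Prop :=
  ∀ p ∈ s, ∃ t ∈ 𝓝[s] p, ∃ (C r : ℝ≥0), 0 < r ∧ HolderOnWith C r f t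

/-- `f (x, y)` has `y`-derivatives of all orders on the open set `O`, and all of them
(including `f` itself, the derivative of order zero) are Hölder in `(x, y)`. -/
structure HasHolderYDerivs {n₁ n₂ : ℕ} {F : Type*} [NormedAddCommGroup F] [NormedSpace ℝ F]
    (f : Euc n₁ × Euc n₂ → F) (O : Set (Euc n₁ × Euc n₂)) : Prop where
  smooth : ∀ x, ContDiffOn ℝ ∞ (fun y => f (x, y)) {y | (x, y) ∈ O}
  holder : ∀ k : ℕ, IsHolderOn (fun p => iteratedFDeriv ℝ k (fun y => f (p.1, y)) p.2) O

/-- The differential at `y` of `f (x, ·)`, where `(x, y) = p`. -/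
noncomputable def yFDeriv {n₁ n₂ : ℕ} {F : Type*} [NormedAddCommGroup F] [NormedSpace ℝ F]
    (f : Euc n₁ × Euc n₂ → F) (p : Euc n₁ × Euc n₂) : Euc n₂ →L[ℝ] F :=
  fderiv ℝ (fun y => f (p.1, y)) p.2

/-- A Hölder foliation chart with smooth leaves: a bi-Hölder homeomorphism `Γ` of an open subset
`Γ.source` of `ℝ^{n₁} × ℝ^{n₂}` onto an open subset `Γ.target` of `ℝ^{n₁ + n₂}`, with Hölder
`y`-derivatives of all orders, and which is an immersion in `y` for fixed `x`. -/
structure IsFoliationChart {n₁ n₂ : ℕ}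
    (Γ : OpenPartialHomeomorph (Euc n₁ × Euc n₂) (Euc (n₁ + n₂))) : Prop where
  derivs : HasHolderYDerivs Γ Γ.source
  holder_symm : IsHolderOn Γ.symm Γ.target
  immersion : ∀ p ∈ Γ.source, Function.Injective (yFDeriv Γ p)

/-- A Hölder foliation with smooth `n₂`-dimensional leaves on `M ⊆ ℝ^{n₁ + n₂}`, given by an atlas
of foliation charts whose images cover `M` and whose transition maps locally send plaques
`{x = const}` into plaques. -/
structure HolderFoliation (n₁ n₂ : ℕ) (M : Set (Euc (n₁ + n₂))) where
  charts : Set (OpenPartialHomeomorph (Euc n₁ × Euc n₂) (Euc (n₁ + n₂)))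
  isChart : ∀ Γ ∈ charts, IsFoliationChart Γ
  cover : ⋃ Γ ∈ charts, Γ.target = M
  compatible : ∀ Γ ∈ charts, ∀ Γ' ∈ charts, ∀ p ∈ Γ.source, Γ p ∈ Γ'.target →
    ∃ W ∈ 𝓝 p, ∀ q ∈ W, ∀ q' ∈ W, q.1 = q'.1 → (Γ'.symm (Γ q)).1 = (Γ'.symm (Γ q')).1

/-- Strong absolute continuity: in every chart Lebesgue measure has a positive continuous density
`J` all of whose `y`-derivatives exist and are Hölder. -/
def HolderFoliation.IsStronglyAbsolutelyContinuous {n₁ n₂ : ℕ} {M : Set (Euc (n₁ + n₂))}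
    (F : HolderFoliation n₁ n₂ M) : Prop :=
  ∀ Γ ∈ F.charts, ∃ J : Euc n₁ × Euc n₂ → ℝ,
    ContinuousOn J Γ.source ∧ (∀ p ∈ Γ.source, 0 < J p) ∧ HasHolderYDerivs J Γ.source ∧
    ∀ φ : Euc (n₁ + n₂) → ℝ, Continuous φ → HasCompactSupport φ → tsupport φ ⊆ Γ.target →
      ∫ z, φ z = ∫ p in Γ.source, φ (Γ p) * J p

/-- The covector `ζ` at `z` (a vector, through the Euclidean inner product) is conormal to the
foliation: it annihilates the tangent space at `z` of the leaf through `z`. The tangent space is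
the range of `d_y Γ` at `Γ⁻¹ z`, for any chart `Γ` around `z`. -/
def HolderFoliation.IsConormal {n₁ n₂ : ℕ} {M : Set (Euc (n₁ + n₂))}
    (F : HolderFoliation n₁ n₂ M) (z ζ : Euc (n₁ + n₂)) : Prop :=
  ∀ Γ ∈ F.charts, z ∈ Γ.target → ∀ v : Euc n₂, inner ℝ (yFDeriv Γ (Γ.symm z) v) ζ = 0

/-! ### Derivatives along the foliation -/

/-- `V_j f`, where the vector field `V_j` on `Γ.target` is the push forward of `∂/∂y_j` by `Γ`
(extended by zero off `Γ.target`). -/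
noncomputable def leafDeriv {n₁ n₂ : ℕ}
    (Γ : OpenPartialHomeomorph (Euc n₁ × Euc n₂) (Euc (n₁ + n₂))) (j : Fin n₂)
    (f : Euc (n₁ + n₂) → ℂ) : Euc (n₁ + n₂) → ℂ :=
  Γ.target.indicator fun z =>
    yFDeriv (fun p => f (Γ p)) (Γ.symm z) (EuclideanSpace.single j (1 : ℝ))

/-- `V_{j₁} (V_{j₂} (⋯ (V_{j_k} f)))` for `I = [j₁, …, j_k]`. -/
noncomputable def iterLeafDeriv {n₁ n₂ : ℕ}
    (Γ : OpenPartialHomeomorph (Euc n₁ × Euc n₂) (Euc (n₁ + n₂))) (I : List (Fin n₂))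
    (f : Euc (n₁ + n₂) → ℂ) : Euc (n₁ + n₂) → ℂ :=
  I.foldr (leafDeriv Γ) f

/-- The space `C^α` of `α`-Hölder functions with compact support in `U`. -/
def holderSpace {n : ℕ} (U : Set (Euc n)) (α : ℝ≥0) : Submodule ℂ (Euc n → ℂ) where
  carrier := {h | HasCompactSupport h ∧ tsupport h ⊆ U ∧ MemHolder α h}
  add_mem' := fun {f g} hf hg =>
    ⟨hf.1.add hg.1, (tsupport_add f g).trans (union_subset hf.2.1 hg.2.1), hf.2.2.add hg.2.2⟩
  zero_mem' := ⟨HasCompactSupport.zero, by simp [tsupport], ⟨0, by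
    intro x y; simp⟩⟩
  smul_mem' := fun c f hf =>
    ⟨hf.1.smul_left (f := fun _ => c), (tsupport_smul_subset_right (fun _ => c) f).trans hf.2.1,
      hf.2.2.smul⟩

/-- The `α`-Hölder norm: supremum norm plus best Hölder constant. -/
noncomputable def holderNorm {n : ℕ} (α : ℝ≥0) (h : Euc n → ℂ) : ℝ :=
  (⨆ z, ‖h z‖) + nnHolderNorm α h

/-- Continuity of a linear functional on the compactly supported `α`-Hölder functions on `U`: it is
bounded in the `α`-Hölder norm on the functions supported in any given compact subset of `U`. -/
def IsHolderContinuousFunctional {n : ℕ} {U : Set (Euc n)} {α : ℝ≥0}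
    (T : holderSpace U α →ₗ[ℂ] ℂ) : Prop :=
  ∀ K : Set (Euc n), IsCompact K → K ⊆ U → ∃ C : ℝ, ∀ h : holderSpace U α,
    tsupport (h : Euc n → ℂ) ⊆ K → ‖T h‖ ≤ C * holderNorm α (h : Euc n → ℂ)

/-- The space `C^{α,k}` of the foliation on the chart domain `Γ.target`: compactly supported
`α`-Hölder functions whose derivatives along the leaves of all orders `≤ k` exist and are
`α`-Hölder as functions on `Γ.target`. -/
def leafHolderSpace {n₁ n₂ : ℕ}
    (Γ : OpenPartialHomeomorph (Euc n₁ × Euc n₂) (Euc (n₁ + n₂))) (α : ℝ≥0) (k : ℕ) :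
    Set (Euc (n₁ + n₂) → ℂ) :=
  {h | h ∈ holderSpace Γ.target α ∧
    (∀ x, ContDiffOn ℝ k (fun y => h (Γ (x, y))) {y | (x, y) ∈ Γ.source}) ∧
    ∀ I : List (Fin n₂), I.length ≤ k → MemHolder α (iterLeafDeriv Γ I h)}

/-- The distribution given by integration against `u`. -/
noncomputable def distOf {n : ℕ} (u : Euc n → ℂ) (h : Euc n → ℂ) : ℂ := ∫ z, u z * h z

/-- The distributional derivative along the foliation: `⟨V_j D, h⟩ = -⟨D, V_j h⟩`. -/
noncomputable def distLeafDeriv {n₁ n₂ : ℕ}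
    (Γ : OpenPartialHomeomorph (Euc n₁ × Euc n₂) (Euc (n₁ + n₂))) (j : Fin n₂)
    (D : (Euc (n₁ + n₂) → ℂ) → ℂ) : (Euc (n₁ + n₂) → ℂ) → ℂ :=
  fun h => -D (leafDeriv Γ j h)

/-- `V_{j₁} (V_{j₂} (⋯ (V_{j_k} D)))` for `I = [j₁, …, j_k]`; a functional on `C^{α,k}`. -/
noncomputable def iterDistLeafDeriv {n₁ n₂ : ℕ}
    (Γ : OpenPartialHomeomorph (Euc n₁ × Euc n₂) (Euc (n₁ + n₂))) (I : List (Fin n₂))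
    (D : (Euc (n₁ + n₂) → ℂ) → ℂ) : (Euc (n₁ + n₂) → ℂ) → ℂ :=
  I.foldr (distLeafDeriv Γ) D

/-- The derivative `V_{j₁} ⋯ V_{j_k} D`, a functional on `C^{α,k}`, belongs to `(C^α)*`: it extends
to a continuous linear functional on the space of compactly supported `α`-Hölder functions. -/
def LeafDerivMemHolderDual {n₁ n₂ : ℕ}
    (Γ : OpenPartialHomeomorph (Euc n₁ × Euc n₂) (Euc (n₁ + n₂))) (I : List (Fin n₂))
    (D : (Euc (n₁ + n₂) → ℂ) → ℂ) (α : ℝ≥0) : Prop :=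
  ∃ T : holderSpace Γ.target α →ₗ[ℂ] ℂ, IsHolderContinuousFunctional T ∧
    ∀ h : holderSpace Γ.target α, (h : Euc (n₁ + n₂) → ℂ) ∈ leafHolderSpace Γ α I.length →
      T h = iterDistLeafDeriv Γ I D h

/-! ### Wave front sets -/

/-- The vector `ζ₀` is not singular at `z₀` for the function `u` on `M`. -/
def IsNotSingular {n : ℕ} (M : Set (Euc n)) (u : Euc n → ℂ) (z₀ ζ₀ : Euc n) : Prop :=
  ∃ U : Set (Euc n), IsOpen U ∧ z₀ ∈ U ∧ U ⊆ M ∧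
  ∃ Z : Set (Euc n), IsOpen Z ∧ ζ₀ ∈ Z ∧ 0 ∉ Z ∧ (∀ ζ ∈ Z, ∀ t : ℝ, 0 < t → t • ζ ∈ Z) ∧
    ∀ N : ℕ, 0 < N → ∀ χ : Euc n → ℂ, ContDiff ℝ ∞ χ → tsupport χ ⊆ U →
      ∃ C : ℝ, ∀ ζ ∈ Z, 1 < ‖ζ‖ →
        ‖∫ z, u z * χ z * Complex.exp (-Complex.I * (inner ℝ z ζ : ℝ))‖ ≤ C * (‖ζ‖ ^ N)⁻¹

/-- The wave front set of the function `u` on `M`, a set of pairs `(z₀, ζ₀)` with `ζ₀ ≠ 0`. -/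
def waveFrontSet {n : ℕ} (M : Set (Euc n)) (u : Euc n → ℂ) : Set (Euc n × Euc n) :=
  {p | p.1 ∈ M ∧ p.2 ≠ 0 ∧ ¬ IsNotSingular M u p.1 p.2}

/-! The mechanism is non-stationary phase along the leaves. If `ζ₀` is not conormal at `z₀`, then in
some chart one field `V_j` satisfies `⟨V_j, η⟩ ≠ 0` for all points near `z₀` and all `η` in a small
closed ball `Ω` about `ζ₀`. Write `w` for the wave with covector `t • η`, pulled back by `Γ`, and
`a` for the pairing of `∂_j Γ` with `η`. Then `∂_j w = -i t a w`, hence `i t Q w = ∂_j(a⁻¹ Q) w -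
∂_j(a⁻¹ Q w)`: a factor `t` is gained either by changing the amplitude or by putting one more leaf
derivative on the test function.

A leaf derivative on the test function costs no power of `t`, because up to sign it moves onto `D`,
and every `V_j^k D` lies in every `(C^γ)*`. It is bounded by the `γ`-Hölder norm of an oscillating
function, which is `O(1 + t)` for every `γ ≤ 1`, whatever `k` is
(`IsFoliationChart.exists_linear_bound`). Iterating the identity gives `O((1 + t) t⁻ᴺ)` for every
`N` (`IsFoliationChart.exists_decay_bound`).

Everything must be uniform in the direction `η`. Amplitudes therefore take values in the Banach
algebra `C(Ω, ℂ)`, where `a` is invertible and sup norms and Hölder constants are automatically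
uniform over `Ω`. Exponents may shrink with the number of derivatives and under transport by `Γ⁻¹`;
this is harmless since the hypothesis on `D` covers all positive exponents. -/

/-! ### Local Hölder continuity -/

/-- `f` is Hölder continuous with exponent `α` near the point `p`. -/
def HolderAt {A F : Type*} [PseudoMetricSpace A] [SeminormedAddCommGroup F] (α : ℝ) (f : A → F)
    (p : A) : Prop :=
  (fun q : A × A => f q.1 - f q.2) =O[𝓝 (p, p)] fun q => dist q.1 q.2 ^ α

section HolderAt

variable {A F G H : Type*} [PseudoMetricSpace A] [NormedAddCommGroup F]
  [NormedAddCommGroup G] [NormedAddCommGroup H] {α β : ℝ} {p : A}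

theorem HolderAt.const (c : F) : HolderAt α (fun _ : A => c) p := by
  simpa [HolderAt] using Asymptotics.isBigO_zero _ _

theorem HolderAt.congr {f g : A → F} (hf : HolderAt α f p) (h : f =ᶠ[𝓝 p] g) :
    HolderAt α g p := by
  refine Asymptotics.IsBigO.congr' hf ?_ Filter.EventuallyEq.rfl
  rw [nhds_prod_eq]
  filter_upwards [h.prod_inl (𝓝 p), h.prod_inr (𝓝 p)] with q h1 h2
  rw [h1, h2]

theorem HolderAt.continuousAt {f : A → F} (hα : 0 < α) (hf : HolderAt α f p) :
    ContinuousAt f p := by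
  have h1 : Filter.Tendsto (fun q : A => (q, p)) (𝓝 p) (𝓝 (p, p)) :=
    (Continuous.prodMk_left p).tendsto p
  have h2 := hf.comp_tendsto h1
  have h3 : Filter.Tendsto (fun q : A => dist q p ^ α) (𝓝 p) (𝓝 0) := by
    have : ContinuousAt (fun q : A => dist q p ^ α) p :=
      ((continuous_id.dist continuous_const).continuousAt).rpow_const (Or.inr hα.le)
    simpa [ContinuousAt, Real.zero_rpow hα.ne'] using this
  have h4 := h2.trans_tendsto h3
  exact tendsto_sub_nhds_zero_iff.1 h4

theorem HolderAt.add {f g : A → F} (hf : HolderAt α f p) (hg : HolderAt α g p) :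
    HolderAt α (fun q => f q + g q) p := by
  refine (Asymptotics.IsBigO.add hf hg).congr_left fun q => ?_
  exact (add_sub_add_comm _ _ _ _).symm

theorem HolderAt.mono {f : A → F} (hf : HolderAt α f p) (hβ : 0 ≤ β) (h : β ≤ α) :
    HolderAt β f p := by
  refine Asymptotics.IsBigO.trans hf ?_
  refine Asymptotics.IsBigO.of_bound 1 ?_
  have : ∀ᶠ q : A × A in 𝓝 (p, p), dist q.1 q.2 < 1 := by
    have hc : ContinuousAt (fun q : A × A => dist q.1 q.2) (p, p) := by fun_prop
    exact hc.eventually (gt_mem_nhds (by simp))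
  filter_upwards [this] with q hq
  rw [one_mul, Real.norm_of_nonneg (by positivity), Real.norm_of_nonneg (by positivity)]
  exact Real.rpow_le_rpow_of_exponent_ge' dist_nonneg hq.le hβ h

theorem HolderAt.comp {A' : Type*} [PseudoMetricSpace A'] {f : A → F} {g : A' → A} {a : A'}
    {C : ℝ} (hα : 0 ≤ α) (hf : HolderAt α f (g a)) (hgc : ContinuousAt g a)
    (hg : ∀ᶠ q in 𝓝 (a, a), dist (g q.1) (g q.2) ≤ C * dist q.1 q.2 ^ β) :
    HolderAt (β * α) (fun q => f (g q)) a := by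
  have h1 : Filter.Tendsto (fun q : A' × A' => (g q.1, g q.2)) (𝓝 (a, a)) (𝓝 (g a, g a)) := by
    rw [nhds_prod_eq, nhds_prod_eq]
    exact Filter.Tendsto.prodMap hgc hgc
  have h2 := hf.comp_tendsto h1
  refine h2.trans ?_
  have h3 : (fun q : A' × A' => dist (g q.1) (g q.2)) =O[𝓝 (a, a)] fun q => dist q.1 q.2 ^ β := by
    refine Asymptotics.IsBigO.of_bound C ?_
    filter_upwards [hg] with q hq
    rwa [Real.norm_of_nonneg dist_nonneg, Real.norm_of_nonneg (by positivity)]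
  have h4 := h3.rpow hα (Filter.Eventually.of_forall fun q => by positivity)
  refine h4.congr_right fun q => ?_
  rw [Real.rpow_mul dist_nonneg]

theorem HolderAt.bilin [NormedSpace ℝ F] [NormedSpace ℝ G] [NormedSpace ℝ H]
    (B : F →L[ℝ] G →L[ℝ] H) {f : A → F} {g : A → G} (hα : 0 < α)
    (hf : HolderAt α f p) (hg : HolderAt α g p) : HolderAt α (fun q => B (f q) (g q)) p := by
  have hfc := hf.continuousAt hα
  have hgc := hg.continuousAt hα
  have key : ∀ {u : A × A → F} {v : A × A → G},
      (fun q => B (u q) (v q)) =O[𝓝 (p, p)] fun q => ‖u q‖ * ‖v q‖ := fun {u v} =>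
    B.isBoundedBilinearMap.isBigO_comp
  have h1 : (fun q : A × A => B (f q.1 - f q.2) (g q.1)) =O[𝓝 (p, p)]
      fun q => dist q.1 q.2 ^ α := by
    refine key.trans ?_
    have hb : (fun q : A × A => ‖g q.1‖) =O[𝓝 (p, p)] fun _ => (1 : ℝ) := by
      have : ContinuousAt (fun q : A × A => g q.1) (p, p) :=
        ContinuousAt.comp (f := Prod.fst) hgc continuousAt_fst
      exact (this.tendsto.norm).isBigO_one ℝ
    simpa using (Asymptotics.IsBigO.norm_left hf).mul hb
  have h2 : (fun q : A × A => B (f q.2) (g q.1 - g q.2)) =O[𝓝 (p, p)]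
      fun q => dist q.1 q.2 ^ α := by
    refine key.trans ?_
    have hb : (fun q : A × A => ‖f q.2‖) =O[𝓝 (p, p)] fun _ => (1 : ℝ) := by
      have : ContinuousAt (fun q : A × A => f q.2) (p, p) :=
        ContinuousAt.comp (f := Prod.snd) hfc continuousAt_snd
      exact (this.tendsto.norm).isBigO_one ℝ
    simpa using hb.mul (Asymptotics.IsBigO.norm_left hg)
  refine (h1.add h2).congr_left fun q => ?_
  simp

/-- Strict differentiability makes `φ` Lipschitz near `f p`, so no exponent is lost. -/
theorem HolderAt.comp_hasStrictFDerivAt [NormedSpace ℝ F] [NormedSpace ℝ G]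
    {f : A → F} {φ : F → G} {φ' : F →L[ℝ] G} (hα : 0 < α)
    (hf : HolderAt α f p)
    (hφ : HasStrictFDerivAt φ φ' (f p)) :
    HolderAt α (fun q => φ (f q)) p := by
  have hfc := hf.continuousAt hα
  have h1 : Filter.Tendsto (fun q : A × A => (f q.1, f q.2)) (𝓝 (p, p)) (𝓝 (f p, f p)) := by
    rw [nhds_prod_eq, nhds_prod_eq]
    exact Filter.Tendsto.prodMap hfc hfc
  exact (hφ.isBigO_sub.comp_tendsto h1).trans hf

theorem HolderOnWith.eventually_dist_le {A B : Type*} [PseudoMetricSpace A] [PseudoMetricSpace B]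
    {f : A → B} {C r : ℝ≥0} {t : Set A} {p : A} (h : HolderOnWith C r f t) (ht : t ∈ 𝓝 p) :
    ∀ᶠ q in 𝓝 (p, p), dist (f q.1) (f q.2) ≤ C * dist q.1 q.2 ^ (r : ℝ) := by
  rw [nhds_prod_eq]
  filter_upwards [Filter.prod_mem_prod ht ht] with q hq
  exact h.dist_le hq.1 hq.2

/-- On a compact subset of an open set, a locally Hölder map has a uniform local exponent. -/
theorem IsHolderOn.exists_uniform {A B : Type*} [PseudoMetricSpace A] [PseudoMetricSpace B]
    {f : A → B} {O K : Set A} (h : IsHolderOn f O) (hO : IsOpen O) (hK : IsCompact K)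
    (hKO : K ⊆ O) : ∃ α : ℝ, 0 < α ∧ α ≤ 1 ∧ ∀ p ∈ K, ∃ C : ℝ,
      ∀ᶠ q in 𝓝 (p, p), dist (f q.1) (f q.2) ≤ C * dist q.1 q.2 ^ α := by
  have mono : ∀ {p : A} {C α β : ℝ}, 0 < β → β ≤ α →
      (∀ᶠ q in 𝓝 (p, p), dist (f q.1) (f q.2) ≤ C * dist q.1 q.2 ^ α) →
      ∀ᶠ q in 𝓝 (p, p), dist (f q.1) (f q.2) ≤ |C| * dist q.1 q.2 ^ β := by
    intro p C α β hβ hle hq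
    have hc : ContinuousAt (fun q : A × A => dist q.1 q.2) (p, p) := by fun_prop
    filter_upwards [hq, hc.eventually (gt_mem_nhds (by simp : dist p p < 1))] with q h1 h2
    refine h1.trans (mul_le_mul (le_abs_self C) ?_ (by positivity) (abs_nonneg C))
    exact Real.rpow_le_rpow_of_exponent_ge' dist_nonneg h2.le hβ.le hle
  refine hK.induction_on (p := fun K => ∃ α : ℝ, 0 < α ∧ α ≤ 1 ∧ ∀ p ∈ K, ∃ C : ℝ,
      ∀ᶠ q in 𝓝 (p, p), dist (f q.1) (f q.2) ≤ C * dist q.1 q.2 ^ α)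
    ⟨1, one_pos, le_rfl, by simp⟩ ?_ ?_ ?_
  · rintro s t hst ⟨α, h0, h1, h2⟩
    exact ⟨α, h0, h1, fun p hp => h2 p (hst hp)⟩
  · rintro s t ⟨α, h0, h1, h2⟩ ⟨β, h3, h4, h5⟩
    refine ⟨min α β, lt_min h0 h3, (min_le_left _ _).trans h1, ?_⟩
    rintro p (hp | hp)
    · obtain ⟨C, hC⟩ := h2 p hp
      exact ⟨|C|, mono (lt_min h0 h3) (min_le_left _ _) hC⟩
    · obtain ⟨C, hC⟩ := h5 p hp
      exact ⟨|C|, mono (lt_min h0 h3) (min_le_right _ _) hC⟩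
  · intro x hx
    obtain ⟨t, ht, C, r, hr, hf⟩ := h x (hKO hx)
    rw [hO.nhdsWithin_eq (hKO hx)] at ht
    -- Every point of `interior t` has `t` as a neighbourhood, so one exponent serves all of them;
    -- it is capped at 1 for later comparisons with Lipschitz bounds.
    refine ⟨interior t, mem_nhdsWithin_of_mem_nhds (interior_mem_nhds.2 ht), min r 1,
      lt_min hr one_pos, min_le_right _ _, fun p hp => ?_⟩
    exact ⟨|(C : ℝ)|, mono (lt_min hr one_pos) (min_le_left _ _)
      (hf.eventually_dist_le (mem_interior_iff_mem_nhds.1 hp))⟩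

theorem holderWith_of_dist_le {A B : Type*} [PseudoMetricSpace A] [PseudoMetricSpace B]
    {f : A → B} {C : ℝ} {γ : ℝ≥0} (hC : 0 ≤ C)
    (h : ∀ x y, dist (f x) (f y) ≤ C * dist x y ^ (γ : ℝ)) : HolderWith C.toNNReal γ f := by
  intro x y
  rw [edist_dist, edist_dist, ENNReal.ofReal_rpow_of_nonneg dist_nonneg γ.coe_nonneg]
  exact (ENNReal.ofReal_le_ofReal (h x y)).trans_eq (ENNReal.ofReal_mul hC)

/-- A compactly supported map that is Hölder near every point is globally Hölder. -/
theorem HolderAt.exists_holderWith {E : Type*} [PseudoMetricSpace E] [ProperSpace E] {f : E → F}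
    {K : Set E} {γ : ℝ≥0} (hγ : 0 < γ) (hK : IsCompact K) (hfK : ∀ z ∉ K, f z = 0)
    (hf : ∀ z, HolderAt γ f z) : ∃ C : ℝ≥0, HolderWith C γ f := by
  have hc : Continuous f :=
    continuous_iff_continuousAt.2 fun z => (hf z).continuousAt (NNReal.coe_pos.2 hγ)
  set L := Metric.cthickening 1 K
  have hL : IsCompact L := hK.cthickening
  have hKL : K ⊆ L := Metric.self_subset_cthickening K
  obtain ⟨C₁, hC₁⟩ : ∃ C : ℝ, ∀ q ∈ L ×ˢ L, ‖f q.1 - f q.2‖ ≤ C * dist q.1 q.2 ^ (γ : ℝ) := by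
    refine (hL.prod hL).induction_on (p := fun S : Set (E × E) => ∃ C : ℝ, ∀ q ∈ S,
      ‖f q.1 - f q.2‖ ≤ C * dist q.1 q.2 ^ (γ : ℝ)) ⟨0, by simp⟩ ?_ ?_ ?_
    · rintro s t hst ⟨C, h⟩
      exact ⟨C, fun q hq => h q (hst hq)⟩
    · rintro s t ⟨C, h⟩ ⟨C', h'⟩
      refine ⟨max C C', ?_⟩
      rintro q (hq | hq)
      · exact (h q hq).trans (by gcongr; exact le_max_left _ _)
      · exact (h' q hq).trans (by gcongr; exact le_max_right _ _)
    · rintro ⟨x, y⟩ -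
      suffices h : ∃ C : ℝ, ∀ᶠ q in 𝓝 (x, y), ‖f q.1 - f q.2‖ ≤ C * dist q.1 q.2 ^ (γ : ℝ) by
        obtain ⟨C, h⟩ := h
        exact ⟨_, mem_nhdsWithin_of_mem_nhds h, C, fun q hq => hq⟩
      -- Near the diagonal the local hypothesis applies. Away from it the Hölder quotient is
      -- continuous, hence locally bounded.
      by_cases hxy : dist x y = 0
      · have hins : 𝓝 (x, y) = 𝓝 (x, x) := by
          rw [nhds_prod_eq, nhds_prod_eq, (Metric.inseparable_iff.2 hxy : 𝓝 x = 𝓝 y)]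
        rw [hins]
        obtain ⟨C, hC⟩ := (hf x).bound
        refine ⟨C, hC.mono fun q hq => ?_⟩
        rwa [Real.norm_of_nonneg (by positivity)] at hq
      · have hpos : dist x y ^ (γ : ℝ) ≠ 0 := (Real.rpow_pos_of_pos
          (lt_of_le_of_ne dist_nonneg (Ne.symm hxy)) _).ne'
        have hq : ContinuousAt (fun q : E × E => ‖f q.1 - f q.2‖ / dist q.1 q.2 ^ (γ : ℝ))
            (x, y) := by
          refine ContinuousAt.div (by fun_prop) ?_ hpos
          exact ContinuousAt.rpow_const (by fun_prop) (Or.inr γ.2)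
        refine ⟨‖f x - f y‖ / dist x y ^ (γ : ℝ) + 1, ?_⟩
        have hd : ContinuousAt (fun q : E × E => dist q.1 q.2) (x, y) := by fun_prop
        filter_upwards [hq.eventually (gt_mem_nhds (lt_add_one _)), hd.eventually_ne hxy]
          with q h1 h2
        have : 0 < dist q.1 q.2 ^ (γ : ℝ) := Real.rpow_pos_of_pos
          (lt_of_le_of_ne dist_nonneg (Ne.symm h2)) _
        exact (div_le_iff₀ this).1 h1.le
  obtain ⟨B, hB⟩ : ∃ B, ∀ z ∈ K, ‖f z‖ ≤ B := hK.exists_bound_of_continuousOn hc.continuousOn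
  -- Points of `K` and points off its unit thickening are at distance at least 1, so the sup bound
  -- is already a Hölder bound there.
  have far : ∀ x ∈ K, ∀ y ∉ L, ‖f x‖ ≤ |B| * dist x y ^ (γ : ℝ) := by
    intro x hx y hy
    have : 1 ≤ dist x y := by
      by_contra! hlt
      refine hy (Metric.mem_cthickening_of_dist_le y x 1 K hx ?_)
      rw [dist_comm]; exact hlt.le
    calc ‖f x‖ ≤ |B| * 1 := by rw [mul_one]; exact (hB x hx).trans (le_abs_self B)
      _ ≤ _ := by gcongr; exact Real.one_le_rpow this γ.2
  refine ⟨(|C₁| + |B|).toNNReal, holderWith_of_dist_le (by positivity) fun x y => ?_⟩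
  have hd : 0 ≤ dist x y ^ (γ : ℝ) := by positivity
  have a1 := mul_nonneg (abs_nonneg C₁) hd
  have a2 := mul_nonneg (abs_nonneg B) hd
  rw [dist_eq_norm]
  by_cases hx : x ∈ L <;> by_cases hy : y ∈ L
  · have := hC₁ (x, y) ⟨hx, hy⟩
    have := mul_le_mul_of_nonneg_right (le_abs_self C₁) hd
    simp only at *
    linarith
  · rw [hfK y fun h => hy (hKL h), sub_zero]
    by_cases hxK : x ∈ K
    · have := far x hxK y hy
      linarith
    · rw [hfK x hxK, norm_zero]
      linarith
  · rw [hfK x fun h => hx (hKL h), zero_sub, norm_neg]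
    by_cases hyK : y ∈ K
    · have := far y hyK x hx
      rw [dist_comm] at this
      linarith
    · rw [hfK y hyK, norm_zero]
      linarith
  · rw [hfK x fun h => hx (hKL h), hfK y fun h => hy (hKL h), sub_zero, norm_zero]
    linarith

end HolderAt

/-! ### Functions with Hölder leafwise derivatives -/

/-- `f (x, y)` has `y`-derivatives up to order `k` on `O`, all of them Hölder of exponent `α` near
every point of `O`. -/
def HolderYDerivs {n₁ n₂ : ℕ} {F : Type} [NormedAddCommGroup F] [NormedSpace ℝ F] (α : ℝ)
    (O : Set (Euc n₁ × Euc n₂)) : ℕ → (Euc n₁ × Euc n₂ → F) → Prop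
  | 0, f => ∀ p ∈ O, HolderAt α f p
  | k + 1, f => (∀ p ∈ O, HolderAt α f p) ∧
      (∀ p ∈ O, DifferentiableAt ℝ (fun y => f (p.1, y)) p.2) ∧
      ∀ v, HolderYDerivs α O k fun p => yFDeriv f p v

namespace HolderYDerivs

variable {n₁ n₂ : ℕ} {F G H : Type} [NormedAddCommGroup F] [NormedSpace ℝ F]
  [NormedAddCommGroup G] [NormedSpace ℝ G] [NormedAddCommGroup H] [NormedSpace ℝ H]
  {α β : ℝ} {O O' : Set (Euc n₁ × Euc n₂)} {k : ℕ} {f g : Euc n₁ × Euc n₂ → F}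

theorem holderAt (h : HolderYDerivs α O k f) : ∀ p ∈ O, HolderAt α f p := by
  cases k with
  | zero => exact h
  | succ k => exact h.1

theorem of_succ (h : HolderYDerivs α O (k + 1) f) : HolderYDerivs α O k f := by
  induction k generalizing f with
  | zero => exact h.1
  | succ k ih => exact ⟨h.1, h.2.1, fun v => ih (h.2.2 v)⟩

theorem of_le {l : ℕ} (hl : l ≤ k) (h : HolderYDerivs α O k f) : HolderYDerivs α O l f := by
  induction hl with
  | refl => exact h
  | step _ ih => exact ih h.of_succ

theorem mono_exponent (h : HolderYDerivs α O k f) (hβ : 0 ≤ β) (hle : β ≤ α) :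
    HolderYDerivs β O k f := by
  induction k generalizing f with
  | zero => exact fun p hp => (h p hp).mono hβ hle
  | succ k ih => exact ⟨fun p hp => (h.1 p hp).mono hβ hle, h.2.1, fun v => ih (h.2.2 v)⟩

theorem mono_set (h : HolderYDerivs α O k f) (hle : O' ⊆ O) : HolderYDerivs α O' k f := by
  induction k generalizing f with
  | zero => exact fun p hp => h p (hle hp)
  | succ k ih =>
    exact ⟨fun p hp => h.1 p (hle hp), fun p hp => h.2.1 p (hle hp), fun v => ih (h.2.2 v)⟩

theorem union (h : HolderYDerivs α O k f) (h' : HolderYDerivs α O' k f) :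
    HolderYDerivs α (O ∪ O') k f := by
  induction k generalizing f with
  | zero => exact fun p hp => hp.elim (h p) (h' p)
  | succ k ih =>
    exact ⟨fun p hp => hp.elim (h.1 p) (h'.1 p), fun p hp => hp.elim (h.2.1 p) (h'.2.1 p),
      fun v => ih (h.2.2 v) (h'.2.2 v)⟩

end HolderYDerivs

/-! ### Calculus of functions with Hölder leafwise derivatives -/

section

variable {n₁ n₂ : ℕ} {F G H : Type} [NormedAddCommGroup F] [NormedSpace ℝ F]
  [NormedAddCommGroup G] [NormedSpace ℝ G] [NormedAddCommGroup H] [NormedSpace ℝ H]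
  {α β : ℝ} {O O' : Set (Euc n₁ × Euc n₂)} {k : ℕ} {f g : Euc n₁ × Euc n₂ → F}

theorem eventuallyEq_slice {F : Type*} {f g : Euc n₁ × Euc n₂ → F}
    (hO : IsOpen O) (hfg : EqOn f g O) {p : Euc n₁ × Euc n₂} (hp : p ∈ O) :
    (fun y => f (p.1, y)) =ᶠ[𝓝 p.2] fun y => g (p.1, y) := by
  have : ∀ᶠ y in 𝓝 p.2, (p.1, y) ∈ O :=
    (Continuous.prodMk_right p.1).continuousAt.eventually (hO.mem_nhds hp)
  filter_upwards [this] with y hy using hfg hy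

theorem yFDeriv_congr (hO : IsOpen O) (hfg : EqOn f g O) {p : Euc n₁ × Euc n₂} (hp : p ∈ O) :
    yFDeriv f p = yFDeriv g p :=
  (eventuallyEq_slice hO hfg hp).fderiv_eq

theorem yFDeriv_eq_zero (hO : IsOpen O) (hf : ∀ p ∈ O, f p = 0) {p : Euc n₁ × Euc n₂}
    (hp : p ∈ O) : yFDeriv f p = 0 := by
  rw [yFDeriv_congr (g := fun _ => 0) hO hf hp]
  simp [yFDeriv]

namespace HolderYDerivs

theorem congr (hO : IsOpen O) (h : HolderYDerivs α O k f) (hfg : EqOn f g O) :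
    HolderYDerivs α O k g := by
  induction k generalizing f g with
  | zero => exact fun p hp => (h p hp).congr (hfg.eventuallyEq_of_mem (hO.mem_nhds hp))
  | succ k ih =>
    refine ⟨fun p hp => (h.1 p hp).congr (hfg.eventuallyEq_of_mem (hO.mem_nhds hp)),
      fun p hp => (h.2.1 p hp).congr_of_eventuallyEq (eventuallyEq_slice hO hfg hp).symm,
      fun v => ih (h.2.2 v) fun p hp => ?_⟩
    simp only [yFDeriv_congr hO hfg hp]

theorem const (c : F) : HolderYDerivs α O k fun _ => c := by
  induction k generalizing c with
  | zero => exact fun p _ => HolderAt.const c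
  | succ k ih =>
    refine ⟨fun p _ => HolderAt.const c, fun p _ => differentiableAt_const c, fun v => ?_⟩
    simpa [yFDeriv] using ih 0

theorem clm (L : F →L[ℝ] G) (hO : IsOpen O) (hα : 0 < α) (h : HolderYDerivs α O k f) :
    HolderYDerivs α O k fun p => L (f p) := by
  induction k generalizing f with
  | zero => exact fun p hp => (h p hp).comp_hasStrictFDerivAt hα L.hasStrictFDerivAt
  | succ k ih =>
    refine ⟨fun p hp => (h.1 p hp).comp_hasStrictFDerivAt hα L.hasStrictFDerivAt,
      fun p hp => L.differentiableAt.comp p.2 (h.2.1 p hp),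
      fun v => (ih (h.2.2 v)).congr hO fun p hp => ?_⟩
    have := L.hasFDerivAt.comp p.2 (h.2.1 p hp).hasFDerivAt
    exact (DFunLike.congr_fun this.fderiv v).symm

theorem add (hO : IsOpen O) (hf : HolderYDerivs α O k f) (hg : HolderYDerivs α O k g) :
    HolderYDerivs α O k fun p => f p + g p := by
  induction k generalizing f g with
  | zero => exact fun p hp => (hf p hp).add (hg p hp)
  | succ k ih =>
    refine ⟨fun p hp => (hf.1 p hp).add (hg.1 p hp),
      fun p hp => (hf.2.1 p hp).add (hg.2.1 p hp),
      fun v => (ih (hf.2.2 v) (hg.2.2 v)).congr hO fun p hp => ?_⟩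
    have := (hf.2.1 p hp).hasFDerivAt.add (hg.2.1 p hp).hasFDerivAt
    exact (DFunLike.congr_fun this.fderiv v).symm

end HolderYDerivs

theorem yFDeriv_bilin (B : F →L[ℝ] G →L[ℝ] H) {g : Euc n₁ × Euc n₂ → G} {p : Euc n₁ × Euc n₂}
    (hf : DifferentiableAt ℝ (fun y => f (p.1, y)) p.2)
    (hg : DifferentiableAt ℝ (fun y => g (p.1, y)) p.2) (v : Euc n₂) :
    yFDeriv (fun p => B (f p) (g p)) p v = B (yFDeriv f p v) (g p) + B (f p) (yFDeriv g p v) := by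
  have := B.hasFDerivAt_of_bilinear hf.hasFDerivAt hg.hasFDerivAt
  refine (DFunLike.congr_fun this.fderiv v).trans ?_
  simp [yFDeriv, add_comm]

namespace HolderYDerivs

theorem bilin (B : F →L[ℝ] G →L[ℝ] H) {g : Euc n₁ × Euc n₂ → G} (hO : IsOpen O) (hα : 0 < α)
    (hf : HolderYDerivs α O k f) (hg : HolderYDerivs α O k g) :
    HolderYDerivs α O k fun p => B (f p) (g p) := by
  induction k generalizing f g with
  | zero => exact fun p hp => (hf p hp).bilin B hα (hg p hp)
  | succ k ih =>
    refine ⟨fun p hp => (hf.1 p hp).bilin B hα (hg.1 p hp), fun p hp =>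
      (B.hasFDerivAt_of_bilinear (hf.2.1 p hp).hasFDerivAt
        (hg.2.1 p hp).hasFDerivAt).differentiableAt, fun v => ?_⟩
    refine ((ih (hf.2.2 v) hg.of_succ).add hO (ih hf.of_succ (hg.2.2 v))).congr hO fun p hp => ?_
    exact (yFDeriv_bilin B (hf.2.1 p hp) (hg.2.1 p hp) v).symm

theorem comp_contDiff {φ : F → G} (hφ : ContDiff ℝ ∞ φ) (hO : IsOpen O) (hα : 0 < α)
    (hf : HolderYDerivs α O k f) : HolderYDerivs α O k fun p => φ (f p) := by
  have hH : ∀ {G : Type} [NormedAddCommGroup G] [NormedSpace ℝ G] {φ : F → G}, ContDiff ℝ ∞ φ →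
      ∀ p ∈ O, HolderAt α (fun p => φ (f p)) p := fun hφ p hp =>
    (hf.holderAt p hp).comp_hasStrictFDerivAt hα
      (hφ.contDiffAt.hasStrictFDerivAt (by simp))
  induction k generalizing G with
  | zero => exact hH hφ
  | succ k ih =>
    have hd : Differentiable ℝ φ := hφ.differentiable (by simp)
    refine ⟨hH hφ, fun p hp => (hd _).comp p.2 (hf.2.1 p hp), fun v => ?_⟩
    have h1 := ih (hφ.fderiv_right (m := ∞) (by simp)) hf.of_succ
    -- The chain rule reads as the bilinear evaluation pairing of `fderiv ℝ φ ∘ f` with the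
    -- derivative of `f`; the induction therefore lets the target of `φ` vary.
    refine (bilin (ContinuousLinearMap.id ℝ (F →L[ℝ] G)) hO hα h1 (hf.2.2 v)).congr hO
      fun p hp => ?_
    have := (hd (f p)).hasFDerivAt.comp p.2 (hf.2.1 p hp).hasFDerivAt
    exact (DFunLike.congr_fun this.fderiv v).symm

/-- The derivative of `a⁻¹` is `-a⁻¹ a⁻¹ a'`, a product of functions already controlled to one order
less, so the induction closes. The case of interest is `𝔸 = C(Ω, ℂ)`. -/
theorem ringInverse {𝔸 : Type} [NormedCommRing 𝔸] [NormedAlgebra ℝ 𝔸] [CompleteSpace 𝔸]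
    {a : Euc n₁ × Euc n₂ → 𝔸} (hO : IsOpen O) (hα : 0 < α) (ha : HolderYDerivs α O k a)
    (hu : ∀ p ∈ O, IsUnit (a p)) : HolderYDerivs α O k fun p => Ring.inverse (a p) := by
  have hH : ∀ p ∈ O, HolderAt α (fun p => Ring.inverse (a p)) p := fun p hp => by
    obtain ⟨u, hu⟩ := hu p hp
    refine (ha.holderAt p hp).comp_hasStrictFDerivAt hα (hu ▸ hasStrictFDerivAt_ringInverse u)
  induction k with
  | zero => exact hH
  | succ k ih =>
    have hfd : ∀ p ∈ O, HasFDerivAt (fun y => Ring.inverse (a (p.1, y)))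
        ((-(ContinuousLinearMap.mulLeftRight ℝ 𝔸) (Ring.inverse (a p)) (Ring.inverse (a p))) ∘L
          yFDeriv a p) p.2 := fun p hp => by
      obtain ⟨u, hu⟩ := hu p hp
      have h1 := hasFDerivAt_ringInverse (𝕜 := ℝ) u
      rw [← hu, Ring.inverse_unit]
      rw [hu] at h1
      exact h1.comp p.2 (ha.2.1 p hp).hasFDerivAt
    refine ⟨hH, fun p hp => (hfd p hp).differentiableAt, fun v => ?_⟩
    have hi := ih ha.of_succ
    have hm := bilin (ContinuousLinearMap.mul ℝ 𝔸) hO hα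
      (bilin (ContinuousLinearMap.mul ℝ 𝔸) hO hα hi hi) (ha.2.2 v)
    refine (hm.clm (-ContinuousLinearMap.id ℝ 𝔸) hO hα).congr hO fun p hp => ?_
    refine Eq.trans ?_ (DFunLike.congr_fun (hfd p hp).fderiv v).symm
    simp [ContinuousLinearMap.mulLeftRight_apply]
    ring

theorem contDiff (hα : 0 < α) (h : HolderYDerivs α univ k f) (x : Euc n₁) :
    ContDiff ℝ k fun y => f (x, y) := by
  induction k generalizing f with
  | zero =>
    refine contDiff_zero.2 (continuous_iff_continuousAt.2 fun y => ?_)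
    exact ContinuousAt.comp (f := fun y => (x, y)) ((h (x, y) trivial).continuousAt hα)
      (Continuous.prodMk_right x).continuousAt
  | succ k ih =>
    push_cast
    refine contDiff_succ_iff_fderiv_apply.2 ⟨fun y => h.2.1 (x, y) trivial, by simp, fun v => ?_⟩
    exact ih (h.2.2 v)

end HolderYDerivs

/-- On a relatively compact open subset, the exponents may be taken uniform in the point. -/
theorem HasHolderYDerivs.exists_holderYDerivs (hf : HasHolderYDerivs f O) (hO : IsOpen O)
    (hO' : IsCompact (closure O')) (hsub : closure O' ⊆ O) (hO'o : IsOpen O') (k : ℕ) :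
    ∃ α : ℝ, 0 < α ∧ α ≤ 1 ∧ HolderYDerivs α O' k f := by
  have hcd : ∀ p ∈ O, ContDiffAt ℝ ∞ (fun y => f (p.1, y)) p.2 := fun p hp =>
    (hf.smooth p.1).contDiffAt
      ((Continuous.prodMk_right p.1).continuousAt.preimage_mem_nhds (hO.mem_nhds hp))
  -- Each order has its own exponent on the compact closure; only finitely many orders occur, so the
  -- minimum is positive.
  have hexp : ∃ α : ℝ, 0 < α ∧ α ≤ 1 ∧ ∀ l ≤ k, ∀ p ∈ O',
      HolderAt α (fun p => iteratedFDeriv ℝ l (fun y => f (p.1, y)) p.2) p := by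
    have one : ∀ l, ∃ α : ℝ, 0 < α ∧ α ≤ 1 ∧ ∀ p ∈ O',
        HolderAt α (fun p => iteratedFDeriv ℝ l (fun y => f (p.1, y)) p.2) p := fun l => by
      obtain ⟨α, h0, h1, h⟩ := (hf.holder l).exists_uniform hO hO' hsub
      refine ⟨α, h0, h1, fun p hp => ?_⟩
      obtain ⟨C, hC⟩ := h p (subset_closure hp)
      refine Asymptotics.IsBigO.of_bound C (hC.mono fun q hq => ?_)
      rwa [← dist_eq_norm, Real.norm_of_nonneg (by positivity)]
    clear hO'
    induction k with
    | zero =>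
      obtain ⟨α, h0, h1, h⟩ := one 0
      exact ⟨α, h0, h1, fun l hl => by rwa [Nat.le_zero.1 hl]⟩
    | succ k ih =>
      obtain ⟨α, h0, h1, h⟩ := ih
      obtain ⟨β, h0', h1', h'⟩ := one (k + 1)
      refine ⟨min α β, lt_min h0 h0', (min_le_left _ _).trans h1, fun l hl p hp => ?_⟩
      rcases Nat.le_succ_iff.1 hl with hl | rfl
      · exact (h l hl p hp).mono (lt_min h0 h0').le (min_le_left _ _)
      · exact (h' p hp).mono (lt_min h0 h0').le (min_le_right _ _)
  obtain ⟨α, h0, h1, hα⟩ := hexp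
  refine ⟨α, h0, h1, ?_⟩
  have hsub' : O' ⊆ O := subset_closure.trans hsub
  -- Induction on the number `m` of derivatives still to be taken: differentiating the `l`-th
  -- derivative evaluated at `w` prepends a vector to `w`.
  have key : ∀ m l : ℕ, l + m ≤ k → ∀ w : Fin l → Euc n₂, HolderYDerivs α O' m
      fun p => iteratedFDeriv ℝ l (fun y => f (p.1, y)) p.2 w := by
    intro m
    induction m with
    | zero =>
      intro l hl w p hp
      exact (hα l (by omega) p hp).comp_hasStrictFDerivAt h0
        (ContinuousMultilinearMap.apply ℝ (fun _ : Fin l => Euc n₂) F w).hasStrictFDerivAt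
    | succ m ih =>
      intro l hl w
      have hd : ∀ p ∈ O', HasFDerivAt
          (fun y => iteratedFDeriv ℝ l (fun y => f (p.1, y)) y w)
          ((ContinuousMultilinearMap.apply ℝ (fun _ : Fin l => Euc n₂) F w) ∘L
            fderiv ℝ (iteratedFDeriv ℝ l fun y => f (p.1, y)) p.2) p.2 := fun p hp =>
        (ContinuousMultilinearMap.apply ℝ (fun _ : Fin l => Euc n₂) F w).hasFDerivAt.comp p.2
          ((hcd p (hsub' hp)).differentiableAt_iteratedFDeriv
            (by exact_mod_cast WithTop.coe_lt_top _)).hasFDerivAt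
      refine ⟨fun p hp => (hα l (by omega) p hp).comp_hasStrictFDerivAt h0
        (ContinuousMultilinearMap.apply ℝ (fun _ : Fin l => Euc n₂) F w).hasStrictFDerivAt,
        fun p hp => (hd p hp).differentiableAt, fun v => ?_⟩
      refine (ih (l + 1) (by omega) (Fin.cons v w)).congr hO'o fun p hp => ?_
      refine Eq.trans ?_ (DFunLike.congr_fun (hd p hp).fderiv v).symm
      simp [iteratedFDeriv_succ_apply_left]
  simpa using key k 0 (by omega) Fin.elim0

end

/-! ### Transport of functions from the chart to the foliated space -/

/-- The function on `ℝⁿ` that is `f ∘ Γ⁻¹` on `Γ.target` and zero elsewhere. -/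
noncomputable def chartPush {n₁ n₂ : ℕ} {F : Type*} [Zero F]
    (Γ : OpenPartialHomeomorph (Euc n₁ × Euc n₂) (Euc (n₁ + n₂))) (f : Euc n₁ × Euc n₂ → F) :
    Euc (n₁ + n₂) → F :=
  Γ.target.indicator fun z => f (Γ.symm z)

/-- The `j`-th partial derivative in `y`. -/
noncomputable def yDeriv {n₁ n₂ : ℕ} {F : Type*} [NormedAddCommGroup F] [NormedSpace ℝ F]
    (j : Fin n₂) (f : Euc n₁ × Euc n₂ → F) : Euc n₁ × Euc n₂ → F :=
  fun p => yFDeriv f p (EuclideanSpace.single j (1 : ℝ))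

/-- Iterated partial derivatives in `y`. -/
noncomputable def iterYDeriv {n₁ n₂ : ℕ} {F : Type*} [NormedAddCommGroup F] [NormedSpace ℝ F]
    (I : List (Fin n₂)) (f : Euc n₁ × Euc n₂ → F) : Euc n₁ × Euc n₂ → F :=
  I.foldr yDeriv f

section

variable {n₁ n₂ : ℕ} {Γ : OpenPartialHomeomorph (Euc n₁ × Euc n₂) (Euc (n₁ + n₂))}
  {F : Type} [NormedAddCommGroup F] [NormedSpace ℝ F] {α : ℝ} {K : Set (Euc n₁ × Euc n₂)}

theorem chartPush_apply {F : Type*} [Zero F] {f : Euc n₁ × Euc n₂ → F}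
    {p : Euc n₁ × Euc n₂} (hp : p ∈ Γ.source) :
    chartPush Γ f (Γ p) = f p := by
  rw [chartPush, indicator_of_mem (Γ.map_source hp), Γ.left_inv hp]

theorem chartPush_eq_zero {F : Type*} [Zero F] {f : Euc n₁ × Euc n₂ → F} (hf : ∀ p ∉ K, f p = 0)
    {z : Euc (n₁ + n₂)} (hz : z ∉ Γ '' K) : chartPush Γ f z = 0 := by
  by_cases h : z ∈ Γ.target
  · rw [chartPush, indicator_of_mem h]
    exact hf _ fun hK => hz ⟨_, hK, Γ.right_inv h⟩
  · rw [chartPush, indicator_of_notMem h]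

/-- The chart conjugates `V_j` to `∂/∂y_j`, so all computations can be done upstairs in `(x, y)`. -/
theorem leafDeriv_chartPush (j : Fin n₂) (f : Euc n₁ × Euc n₂ → ℂ) :
    leafDeriv Γ j (chartPush Γ f) = chartPush Γ (yDeriv j f) := by
  funext z
  by_cases hz : z ∈ Γ.target
  · have h1 := yFDeriv_congr (f := fun p => chartPush Γ f (Γ p)) (g := f) Γ.open_source
      (fun p hp => chartPush_apply hp) (Γ.map_target hz)
    rw [leafDeriv, indicator_of_mem hz, h1, chartPush, indicator_of_mem hz, yDeriv]
  · rw [leafDeriv, indicator_of_notMem hz, chartPush, indicator_of_notMem hz]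

theorem iterLeafDeriv_chartPush (I : List (Fin n₂)) (f : Euc n₁ × Euc n₂ → ℂ) :
    iterLeafDeriv Γ I (chartPush Γ f) = chartPush Γ (iterYDeriv I f) := by
  induction I with
  | nil => rfl
  | cons j I ih =>
    change leafDeriv Γ j (iterLeafDeriv Γ I (chartPush Γ f)) = _
    rw [ih, leafDeriv_chartPush]
    rfl

theorem HolderYDerivs.iterYDeriv {O : Set (Euc n₁ × Euc n₂)} {f : Euc n₁ × Euc n₂ → F}
    (I : List (Fin n₂)) {l : ℕ} (hf : HolderYDerivs α O (l + I.length) f) :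
    HolderYDerivs α O l (iterYDeriv I f) := by
  induction I generalizing l with
  | nil => exact hf
  | cons j I ih =>
    have := ih (l := l + 1) (by rwa [List.length_cons, ← Nat.add_assoc, Nat.add_right_comm] at hf)
    exact this.2.2 _

theorem iterYDeriv_eq_zero (hK : IsClosed K) {f : Euc n₁ × Euc n₂ → F} (hf : ∀ p ∉ K, f p = 0)
    (I : List (Fin n₂)) : ∀ p ∉ K, iterYDeriv I f p = 0 := by
  induction I with
  | nil => exact hf
  | cons j I ih =>
    intro p hp
    change yFDeriv (iterYDeriv I f) p _ = 0
    rw [yFDeriv_eq_zero hK.isOpen_compl ih hp]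
    rfl

theorem iterYDeriv_linear {f g : Euc n₁ × Euc n₂ → ℂ} (c : ℂ) (I : List (Fin n₂))
    (hf : HolderYDerivs α univ I.length f) (hg : HolderYDerivs α univ I.length g) :
    iterYDeriv I (fun p => c * f p + g p) = fun p => c * iterYDeriv I f p + iterYDeriv I g p := by
  induction I with
  | nil => rfl
  | cons j I ih =>
    funext p
    change yFDeriv (iterYDeriv I _) p _ = _
    rw [ih hf.of_succ hg.of_succ]
    have h1 := (HolderYDerivs.iterYDeriv (f := f) (O := univ) (α := α) I (l := 1)
      (by rwa [Nat.add_comm])).2.1 p (mem_univ p)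
    have h2 := (HolderYDerivs.iterYDeriv (f := g) (O := univ) (α := α) I (l := 1)
      (by rwa [Nat.add_comm])).2.1 p (mem_univ p)
    exact DFunLike.congr_fun ((h1.hasFDerivAt.const_mul c).add h2.hasFDerivAt).fderiv _

/-- Transposition reverses the order of the fields, which is invisible when all of them are the same
`V_j`; no other iterated derivative is needed. -/
theorem iterDistLeafDeriv_replicate (j : Fin n₂) (D : (Euc (n₁ + n₂) → ℂ) → ℂ) (k : ℕ)
    (h : Euc (n₁ + n₂) → ℂ) :
    iterDistLeafDeriv Γ (List.replicate k j) D h =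
      (-1) ^ k * D (iterLeafDeriv Γ (List.replicate k j) h) := by
  induction k generalizing h with
  | zero => simp [iterDistLeafDeriv, iterLeafDeriv]
  | succ k ih =>
    have h1 : iterLeafDeriv Γ (List.replicate (k + 1) j) h =
        iterLeafDeriv Γ (List.replicate k j) (leafDeriv Γ j h) := by
      rw [List.replicate_succ', iterLeafDeriv, List.foldr_append]
      rfl
    rw [h1, pow_succ]
    change -iterDistLeafDeriv Γ (List.replicate k j) D (leafDeriv Γ j h) = _
    rw [ih]
    ring

/-- Near `Γ '' K` the exponent of `Γ⁻¹` is uniform by compactness, and elsewhere the function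
vanishes locally. Since `β` depends on `K` alone, a vector-valued amplitude, the scalar test
functions and their leaf derivatives can share one exponent. -/
theorem IsFoliationChart.exists_holderAt_chartPush (hΓ : IsFoliationChart Γ) (hK : IsCompact K)
    (hKs : K ⊆ Γ.source) : ∃ β : ℝ, 0 < β ∧ β ≤ 1 ∧ ∀ {F : Type} [NormedAddCommGroup F]
      {α : ℝ} {f : Euc n₁ × Euc n₂ → F}, 0 ≤ α → (∀ p, HolderAt α f p) →
      (∀ p ∉ K, f p = 0) → ∀ z, HolderAt (β * α) (chartPush Γ f) z := by
  have hK' : IsCompact (Γ '' K) := hK.image_of_continuousOn (Γ.continuousOn.mono hKs)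
  have hKt : Γ '' K ⊆ Γ.target := by
    rintro _ ⟨p, hp, rfl⟩
    exact Γ.map_source (hKs hp)
  obtain ⟨β, h0, h1, hβ⟩ := hΓ.holder_symm.exists_uniform Γ.open_target hK' hKt
  refine ⟨β, h0, h1, fun {F} _ {α f} hα hf hfK z => ?_⟩
  by_cases hz : z ∈ Γ '' K
  · obtain ⟨C, hC⟩ := hβ z hz
    refine ((hf (Γ.symm z)).comp hα (Γ.symm.continuousAt (hKt hz)) hC).congr ?_
    filter_upwards [Γ.open_target.mem_nhds (hKt hz)] with w hw
    rw [chartPush, indicator_of_mem hw]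
  · refine (HolderAt.const 0).congr ?_
    filter_upwards [hK'.isClosed.isOpen_compl.mem_nhds hz] with w hw
    exact (chartPush_eq_zero hfK hw).symm

/-- The transported function is continuous and bounded. This integrability is what makes `distOf u`
additive on the functions that occur. -/
theorem IsFoliationChart.integrable_mul_chartPush (hΓ : IsFoliationChart Γ) (hK : IsCompact K)
    (hKs : K ⊆ Γ.source) {u : Euc (n₁ + n₂) → ℂ} (hu : IntegrableOn u Γ.target volume)
    {f : Euc n₁ × Euc n₂ → ℂ} (hα : 0 < α) (hf : ∀ p, HolderAt α f p) (hfK : ∀ p ∉ K, f p = 0) :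
    Integrable (fun z => u z * chartPush Γ f z) volume := by
  obtain ⟨β, h0, -, hβ⟩ := hΓ.exists_holderAt_chartPush hK hKs
  have hc : Continuous (chartPush Γ f) := continuous_iff_continuousAt.2 fun z =>
    (hβ hα.le hf hfK z).continuousAt (mul_pos h0 hα)
  have hK' : IsCompact (Γ '' K) := hK.image_of_continuousOn (Γ.continuousOn.mono hKs)
  obtain ⟨B, hB⟩ := hK'.exists_bound_of_continuousOn hc.continuousOn
  have hB' : ∀ z, ‖chartPush Γ f z‖ ≤ |B| := fun z => by
    by_cases hz : z ∈ Γ '' K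
    · exact (hB z hz).trans (le_abs_self B)
    · rw [chartPush_eq_zero hfK hz, norm_zero]
      exact abs_nonneg B
  have h1 : IntegrableOn (fun z => u z * chartPush Γ f z) Γ.target volume :=
    hu.mul_bdd hc.aestronglyMeasurable (Filter.Eventually.of_forall hB')
  refine (integrableOn_iff_integrable_of_support_subset fun z hz => ?_).1 h1
  by_contra h
  refine hz ?_
  simp only [chartPush, indicator_of_notMem h, mul_zero]

end

/-! ### Oscillating test functions -/

/-- The map `z ↦ (η ↦ ⟨z, η⟩)` into the continuous functions on a compact set of covectors. -/
noncomputable def covectorPairing {n : ℕ} (Ω : Set (Euc n)) : Euc n →L[ℝ] C(Ω, ℂ) :=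
  LinearMap.toContinuousLinearMap
    { toFun := fun z => ⟨fun η => ((inner ℝ z (η : Euc n) : ℝ) : ℂ), by fun_prop⟩
      map_add' := fun z w => by ext η; simp [inner_add_left]
      map_smul' := fun c z => by ext η; simp [inner_smul_left] }

/-- The function `p ↦ exp (-i ⟨Γ p, ζ⟩)`. -/
noncomputable def chartWave {n₁ n₂ : ℕ} (Γ : Euc n₁ × Euc n₂ → Euc (n₁ + n₂))
    (ζ : Euc (n₁ + n₂)) : Euc n₁ × Euc n₂ → ℂ :=
  fun p => Complex.exp (-Complex.I * (inner ℝ (Γ p) ζ : ℝ))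

/-- Functions that are smooth along the leaves with Hölder derivatives and vanish off `K`. -/
def IsLeafTest {n₁ n₂ : ℕ} {F : Type} [NormedAddCommGroup F] [NormedSpace ℝ F]
    (K : Set (Euc n₁ × Euc n₂)) (Q : Euc n₁ × Euc n₂ → F) : Prop :=
  (∀ k, ∃ α : ℝ, 0 < α ∧ α ≤ 1 ∧ HolderYDerivs α univ k Q) ∧ ∀ p ∉ K, Q p = 0

section

variable {n₁ n₂ : ℕ} {Γ : OpenPartialHomeomorph (Euc n₁ × Euc n₂) (Euc (n₁ + n₂))}
  {K O : Set (Euc n₁ × Euc n₂)}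

theorem covectorPairing_apply {n : ℕ} (Ω : Set (Euc n)) (z : Euc n) (η : Ω) :
    covectorPairing Ω z η = ((inner ℝ z (η : Euc n) : ℝ) : ℂ) := rfl

theorem contDiff_wave {n : ℕ} (ζ : Euc n) :
    ContDiff ℝ ∞ fun z : Euc n => Complex.exp (-Complex.I * (inner ℝ z ζ : ℝ)) := by
  have h1 : ContDiff ℝ ∞ fun z : Euc n => ((inner ℝ z ζ : ℝ) : ℂ) :=
    Complex.ofRealCLM.contDiff.comp (contDiff_id.inner ℝ contDiff_const)
  exact (contDiff_const.mul h1).cexp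

theorem hasFDerivAt_wave {n : ℕ} (ζ z : Euc n) :
    HasFDerivAt (fun z : Euc n => Complex.exp (-Complex.I * (inner ℝ z ζ : ℝ)))
      (Complex.exp (-Complex.I * (inner ℝ z ζ : ℝ)) •
        ((-Complex.I) • (Complex.ofRealCLM ∘L innerSL ℝ ζ))) z := by
  have h1 : HasFDerivAt (fun z : Euc n => ((inner ℝ z ζ : ℝ) : ℂ))
      (Complex.ofRealCLM ∘L innerSL ℝ ζ) z := by
    have := (Complex.ofRealCLM ∘L innerSL ℝ ζ).hasFDerivAt (x := z)
    refine this.congr_of_eventuallyEq (Filter.Eventually.of_forall fun w => ?_)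
    simp [real_inner_comm]
  exact (h1.const_mul (-Complex.I)).cexp

theorem yDeriv_wave_mul {q : Euc n₁ × Euc n₂ → ℂ} (ζ : Euc (n₁ + n₂)) (j : Fin n₂)
    {p : Euc n₁ × Euc n₂} (hq : DifferentiableAt ℝ (fun y => q (p.1, y)) p.2)
    (hΓ : DifferentiableAt ℝ (fun y => Γ (p.1, y)) p.2) :
    yDeriv j (fun p => q p * chartWave Γ ζ p) p = yDeriv j q p * chartWave Γ ζ p +
      q p * (-Complex.I * (inner ℝ (yDeriv j Γ p) ζ : ℝ) * chartWave Γ ζ p) := by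
  have h1 := HasFDerivAt.comp (g := fun z => Complex.exp (-Complex.I * (inner ℝ z ζ : ℝ)))
    (f := fun y => Γ (p.1, y)) p.2 (hasFDerivAt_wave ζ (Γ p)) hΓ.hasFDerivAt
  refine (yFDeriv_bilin (ContinuousLinearMap.mul ℝ ℂ) hq h1.differentiableAt _).trans ?_
  have h2 : yFDeriv (chartWave Γ ζ) p = _ := h1.fderiv
  rw [h2]
  simp only [yDeriv, ContinuousLinearMap.mul_apply', ContinuousLinearMap.comp_apply,
    smul_apply, smul_eq_mul, Complex.ofRealCLM_apply, innerSL_apply_apply,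
    chartWave, yFDeriv, real_inner_comm]
  ring

theorem HolderYDerivs.univ_of_vanish {F : Type} [NormedAddCommGroup F] [NormedSpace ℝ F] {α : ℝ}
    {k : ℕ} {f : Euc n₁ × Euc n₂ → F} (hK : IsClosed K) (hKO : K ⊆ O)
    (hf : HolderYDerivs α O k f) (hfK : ∀ p ∉ K, f p = 0) : HolderYDerivs α univ k f := by
  have h1 : HolderYDerivs α Kᶜ k f :=
    (HolderYDerivs.const (0 : F)).congr hK.isOpen_compl fun p hp => (hfK p hp).symm
  refine (hf.union h1).mono_set fun p _ => ?_
  by_cases hp : p ∈ K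
  · exact Or.inl (hKO hp)
  · exact Or.inr hp

theorem IsLeafTest.yDeriv {F : Type} [NormedAddCommGroup F] [NormedSpace ℝ F]
    {Q : Euc n₁ × Euc n₂ → F} (hK : IsClosed K) (hQ : IsLeafTest K Q) (j : Fin n₂) :
    IsLeafTest K (yDeriv j Q) := by
  refine ⟨fun k => ?_, iterYDeriv_eq_zero hK hQ.2 [j]⟩
  obtain ⟨α, h0, h1, h⟩ := hQ.1 (k + 1)
  exact ⟨α, h0, h1, h.2.2 _⟩

/-- The factor `b` is controlled only on a neighbourhood of `K`, which suits `b = a⁻¹`: the pairing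
need not be invertible elsewhere. -/
theorem IsLeafTest.mul_left {𝔸 : Type} [NormedCommRing 𝔸] [NormedAlgebra ℝ 𝔸]
    {b Q : Euc n₁ × Euc n₂ → 𝔸} (hK : IsClosed K) (hO : IsOpen O) (hKO : K ⊆ O)
    (hb : ∀ k, ∃ α : ℝ, 0 < α ∧ α ≤ 1 ∧ HolderYDerivs α O k b) (hQ : IsLeafTest K Q) :
    IsLeafTest K fun p => b p * Q p := by
  have hz : ∀ p ∉ K, b p * Q p = 0 := fun p hp => by rw [hQ.2 p hp, mul_zero]
  refine ⟨fun k => ?_, hz⟩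
  obtain ⟨α, h0, h1, h⟩ := hb k
  obtain ⟨β, h0', h1', h'⟩ := hQ.1 k
  have hm := lt_min h0 h0'
  refine ⟨min α β, hm, (min_le_left _ _).trans h1, ?_⟩
  exact (HolderYDerivs.bilin (ContinuousLinearMap.mul ℝ 𝔸) hO hm
    (h.mono_exponent hm.le (min_le_left _ _))
    ((h'.mono_set (subset_univ O)).mono_exponent hm.le (min_le_right _ _))).univ_of_vanish hK hKO hz

/-- The wave is a smooth function of `Γ`, so its exponent is that of `Γ` and does not depend on `η`
or `ζ`. Only qualitative regularity is claimed; the dependence on frequency is measured separately.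
-/
theorem IsFoliationChart.exists_holderYDerivs_wave (hΓ : IsFoliationChart Γ) (hK : IsCompact K)
    (hKs : K ⊆ Γ.source) {Ω : Set (Euc (n₁ + n₂))} [CompactSpace Ω]
    {Q : Euc n₁ × Euc n₂ → C(Ω, ℂ)} (hQ : IsLeafTest K Q) (k : ℕ) :
    ∃ α : ℝ, 0 < α ∧ α ≤ 1 ∧ HolderYDerivs α univ k Q ∧ ∀ (η : Ω) (ζ : Euc (n₁ + n₂)),
      HolderYDerivs α univ k fun p => Q p η * chartWave Γ ζ p := by
  obtain ⟨O', hO', hKO', hcl, hcpt⟩ :=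
    exists_open_between_and_isCompact_closure hK Γ.open_source hKs
  obtain ⟨α, h0, h1, h⟩ := hΓ.derivs.exists_holderYDerivs Γ.open_source hcpt hcl hO' k
  obtain ⟨β, h0', h1', h'⟩ := hQ.1 k
  have hm := lt_min h0 h0'
  have hQ' := h'.mono_exponent hm.le (min_le_right α β)
  refine ⟨min α β, hm, (min_le_left _ _).trans h1, hQ', fun η ζ => ?_⟩
  have hw : HolderYDerivs (min α β) O' k (chartWave Γ ζ) :=
    HolderYDerivs.comp_contDiff (φ := fun z => Complex.exp (-Complex.I * (inner ℝ z ζ : ℝ)))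
      (contDiff_wave ζ) hO' hm (h.mono_exponent hm.le (min_le_left α β))
  have hq : HolderYDerivs (min α β) O' k fun p => Q p η :=
    (hQ'.mono_set (subset_univ O')).clm (ContinuousMap.evalCLM ℝ η) hO' hm
  exact (HolderYDerivs.bilin (ContinuousLinearMap.mul ℝ ℂ) hO' hm hq hw).univ_of_vanish
    hK.isClosed hKO' fun p hp => by simp [hQ.2 p hp]

end

/-! ### Integration by parts along the leaves -/

theorem norm_wave {n : ℕ} (ζ z : Euc n) :
    ‖Complex.exp (-Complex.I * (inner ℝ z ζ : ℝ))‖ = 1 := by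
  have : -Complex.I * ((inner ℝ z ζ : ℝ) : ℂ) = ((-(inner ℝ z ζ) : ℝ) : ℂ) * Complex.I := by
    push_cast; ring
  rw [this, Complex.norm_exp_ofReal_mul_I]

/-- For `dist z w ≤ 1` the Lipschitz bound with constant `‖ζ‖` is interpolated down to `γ`; for
larger distances the trivial bound 2 suffices. -/
theorem norm_wave_sub_le {n : ℕ} (ζ z w : Euc n) {γ : ℝ} (h0 : 0 ≤ γ) (h1 : γ ≤ 1) :
    ‖Complex.exp (-Complex.I * (inner ℝ z ζ : ℝ)) - Complex.exp (-Complex.I * (inner ℝ w ζ : ℝ))‖ ≤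
      (2 + ‖ζ‖) * dist z w ^ γ := by
  rcases le_total (dist z w) 1 with hd | hd
  · have e1 : Complex.exp (-Complex.I * (inner ℝ z ζ : ℝ)) -
        Complex.exp (-Complex.I * (inner ℝ w ζ : ℝ)) =
        Complex.exp (-Complex.I * (inner ℝ w ζ : ℝ)) *
          (Complex.exp (Complex.I * ((inner ℝ (w - z) ζ : ℝ) : ℂ)) - 1) := by
      rw [mul_sub, mul_one, ← Complex.exp_add, inner_sub_left]
      congr 2
      push_cast
      ring
    rw [e1, norm_mul, norm_wave, one_mul]
    calc _ ≤ ‖(inner ℝ (w - z) ζ : ℝ)‖ := Real.norm_exp_I_mul_ofReal_sub_one_le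
      _ ≤ ‖w - z‖ * ‖ζ‖ := norm_inner_le_norm _ _
      _ = ‖ζ‖ * dist z w ^ (1 : ℝ) := by
        rw [Real.rpow_one, dist_comm, dist_eq_norm, mul_comm]
      _ ≤ ‖ζ‖ * dist z w ^ γ := by
        gcongr ?_ * ?_
        exact Real.rpow_le_rpow_of_exponent_ge' dist_nonneg hd h0 h1
      _ ≤ _ := by gcongr; linarith
  · calc _ ≤ ‖Complex.exp (-Complex.I * (inner ℝ z ζ : ℝ))‖ +
          ‖Complex.exp (-Complex.I * (inner ℝ w ζ : ℝ))‖ := norm_sub_le _ _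
      _ = 2 * 1 := by rw [norm_wave, norm_wave]; norm_num
      _ ≤ _ := by
        gcongr
        · linarith [norm_nonneg ζ]
        · exact Real.one_le_rpow hd h0

section

variable {n₁ n₂ : ℕ} {Γ : OpenPartialHomeomorph (Euc n₁ × Euc n₂) (Euc (n₁ + n₂))}
  {K O : Set (Euc n₁ × Euc n₂)} {Ω : Set (Euc (n₁ + n₂))} [CompactSpace Ω]
  {u : Euc (n₁ + n₂) → ℂ} {j : Fin n₂} {Q : Euc n₁ × Euc n₂ → C(Ω, ℂ)}

omit [CompactSpace Ω] in
theorem chartPush_wave (η : Ω) (ζ : Euc (n₁ + n₂)) (z : Euc (n₁ + n₂)) :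
    chartPush Γ (fun p => Q p η * chartWave Γ ζ p) z =
      chartPush Γ Q z η * Complex.exp (-Complex.I * (inner ℝ z ζ : ℝ)) := by
  by_cases hz : z ∈ Γ.target
  · simp only [chartPush, indicator_of_mem hz, chartWave, Γ.right_inv hz]
  · simp [chartPush, indicator_of_notMem hz]

theorem chartPush_mem_leafHolderSpace (hK : IsCompact K) (hKs : K ⊆ Γ.source)
    {f : Euc n₁ × Euc n₂ → ℂ} {α : ℝ} (hα : 0 < α) {γ : ℝ≥0} (hγ : 0 < γ) {k : ℕ}
    (hf : HolderYDerivs α univ k f) (hfK : ∀ p ∉ K, f p = 0)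
    (hpush : ∀ {f : Euc n₁ × Euc n₂ → ℂ}, (∀ p, HolderAt α f p) → (∀ p ∉ K, f p = 0) →
      ∀ z, HolderAt γ (chartPush Γ f) z) :
    chartPush Γ f ∈ leafHolderSpace Γ γ k ∧ tsupport (chartPush Γ f) ⊆ Γ '' K := by
  have hK' : IsCompact (Γ '' K) := hK.image_of_continuousOn (Γ.continuousOn.mono hKs)
  have hKt : Γ '' K ⊆ Γ.target := by
    rintro _ ⟨p, hp, rfl⟩
    exact Γ.map_source (hKs hp)
  have hz : ∀ z ∉ Γ '' K, chartPush Γ f z = 0 := fun z => chartPush_eq_zero hfK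
  have hts : tsupport (chartPush Γ f) ⊆ Γ '' K :=
    closure_minimal (fun z hz' => by_contra fun h => hz' (hz z h)) hK'.isClosed
  have hmem : ∀ {g : Euc n₁ × Euc n₂ → ℂ}, (∀ p, HolderAt α g p) → (∀ p ∉ K, g p = 0) →
      MemHolder γ (chartPush Γ g) := fun hg hgK =>
    HolderAt.exists_holderWith hγ hK' (fun z => chartPush_eq_zero hgK) (hpush hg hgK)
  have hfH : ∀ p, HolderAt α f p := fun p => hf.holderAt p (mem_univ p)
  refine ⟨⟨⟨HasCompactSupport.intro hK' hz, hts.trans hKt, hmem hfH hfK⟩, fun x => ?_,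
    fun I hI => ?_⟩, hts⟩
  · exact (hf.contDiff hα x).contDiffOn.congr fun y hy => chartPush_apply hy
  · rw [iterLeafDeriv_chartPush]
    have h1 : HolderYDerivs α univ 0 (iterYDeriv I f) :=
      HolderYDerivs.iterYDeriv I (hf.of_le (by omega))
    exact hmem (fun p => h1 p (mem_univ p)) (iterYDeriv_eq_zero hK.isClosed hfK I)

/-- The crude bound: a leafwise derivative of the distribution grows at most linearly in the
frequency when tested against an oscillating function. -/
theorem IsFoliationChart.exists_linear_bound (hΓ : IsFoliationChart Γ) (hK : IsCompact K)
    (hKs : K ⊆ Γ.source) (k : ℕ)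
    (hD : ∀ α : ℝ≥0, 0 < α → LeafDerivMemHolderDual Γ (List.replicate k j) (distOf u) α)
    {R : ℝ} (hR : ∀ η : Ω, ‖(η : Euc (n₁ + n₂))‖ ≤ R) (hR0 : 0 ≤ R) (hQ : IsLeafTest K Q) :
    ∃ C : ℝ, 0 ≤ C ∧ ∀ (η : Ω) (t : ℝ), 0 < t →
      ‖distOf u (chartPush Γ (iterYDeriv (List.replicate k j)
        fun p => Q p η * chartWave Γ (t • (η : Euc (n₁ + n₂))) p))‖ ≤ C * (1 + t) := by
  obtain ⟨α, hα0, hα1, hQα, hw⟩ := hΓ.exists_holderYDerivs_wave hK hKs hQ k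
  obtain ⟨β, hβ0, hβ1, hβ⟩ := hΓ.exists_holderAt_chartPush hK hKs
  have hγ0 : 0 < β * α := mul_pos hβ0 hα0
  have hγ1 : β * α ≤ 1 := mul_le_one₀ hβ1 hα0.le hα1
  -- The exponent of the dual space is dictated by `Q`, `k` and the chart; this is why the
  -- hypothesis on `D` is needed for arbitrarily small exponents.
  obtain ⟨γ, hγ⟩ : ∃ γ : ℝ≥0, (γ : ℝ) = β * α := ⟨⟨β * α, hγ0.le⟩, rfl⟩
  rw [← hγ] at hγ0 hγ1
  have hγ0' : 0 < γ := NNReal.coe_pos.1 hγ0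
  have hK' : IsCompact (Γ '' K) := hK.image_of_continuousOn (Γ.continuousOn.mono hKs)
  have hKt : Γ '' K ⊆ Γ.target := by
    rintro _ ⟨p, hp, rfl⟩
    exact Γ.map_source (hKs hp)
  -- A Hölder constant in the sup norm of `C(Ω, ℂ)` bounds all the scalar amplitudes `Q · η` at
  -- once.
  obtain ⟨CQ, hCQ⟩ := HolderAt.exists_holderWith (f := chartPush Γ Q) hγ0' hK'
    (fun z => chartPush_eq_zero hQ.2)
    (hγ ▸ hβ hα0.le (fun p => hQα.holderAt p (mem_univ p)) hQ.2)
  obtain ⟨B, hB0, hB⟩ : ∃ B : ℝ, 0 ≤ B ∧ ∀ z, ‖chartPush Γ Q z‖ ≤ B := by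
    obtain ⟨B, hB⟩ := hK'.exists_bound_of_continuousOn (hCQ.continuous hγ0').continuousOn
    refine ⟨|B|, abs_nonneg B, fun z => ?_⟩
    by_cases hz : z ∈ Γ '' K
    · exact (hB z hz).trans (le_abs_self B)
    · rw [chartPush_eq_zero hQ.2 hz, norm_zero]
      exact abs_nonneg B
  obtain ⟨T, hT, hTD⟩ := hD γ hγ0'
  obtain ⟨CT, hCT⟩ := hT _ hK' hKt
  refine ⟨|CT| * (CQ + B * 3 + B * R), by positivity, fun η t ht => ?_⟩
  set ζ : Euc (n₁ + n₂) := t • (η : Euc (n₁ + n₂))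
  set f : Euc n₁ × Euc n₂ → ℂ := fun p => Q p η * chartWave Γ ζ p
  obtain ⟨hmem, hts⟩ := chartPush_mem_leafHolderSpace hK hKs hα0 hγ0' (hw η ζ)
    (fun p hp => by simp [hQ.2 p hp]) (fun hf hfK => hγ ▸ hβ hα0.le hf hfK)
  have h1 : ‖distOf u (chartPush Γ (iterYDeriv (List.replicate k j) f))‖ =
      ‖T ⟨chartPush Γ f, hmem.1⟩‖ := by
    rw [hTD _ (by rwa [List.length_replicate]), iterDistLeafDeriv_replicate,
      iterLeafDeriv_chartPush, norm_mul, norm_pow, norm_neg, norm_one, one_pow, one_mul]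
  have hζ : ‖ζ‖ ≤ t * R := by
    rw [norm_smul, Real.norm_of_nonneg ht.le]
    gcongr
    exact hR η
  have hbd : ∀ z, ‖chartPush Γ Q z η‖ ≤ B := fun z =>
    ((chartPush Γ Q z).norm_coe_le_norm η).trans (hB z)
  have hsup : (⨆ z, ‖chartPush Γ f z‖) ≤ B := by
    refine ciSup_le fun z => ?_
    rw [chartPush_wave, norm_mul, norm_wave, mul_one]
    exact hbd z
  have hhol : (nnHolderNorm γ (chartPush Γ f) : ℝ) ≤ CQ + B * (2 + t * R) := by
    have h0 : 0 ≤ CQ + B * (2 + t * R) := by positivity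
    refine (NNReal.coe_le_coe.2 (holderWith_of_dist_le h0 fun z w => ?_).nnholderNorm_le).trans_eq
      (Real.coe_toNNReal _ h0)
    rw [chartPush_wave, chartPush_wave, dist_eq_norm]
    have e1 : chartPush Γ Q z η * Complex.exp (-Complex.I * (inner ℝ z ζ : ℝ)) -
        chartPush Γ Q w η * Complex.exp (-Complex.I * (inner ℝ w ζ : ℝ)) =
        (chartPush Γ Q z - chartPush Γ Q w) η * Complex.exp (-Complex.I * (inner ℝ z ζ : ℝ)) +
        chartPush Γ Q w η * (Complex.exp (-Complex.I * (inner ℝ z ζ : ℝ)) -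
          Complex.exp (-Complex.I * (inner ℝ w ζ : ℝ))) := by
      rw [ContinuousMap.sub_apply]
      ring
    rw [e1]
    refine (norm_add_le _ _).trans ?_
    rw [norm_mul, norm_mul, norm_wave, mul_one, add_mul]
    refine add_le_add ?_ ?_
    · refine ((chartPush Γ Q z - chartPush Γ Q w).norm_coe_le_norm η).trans ?_
      rw [← dist_eq_norm]
      exact hCQ.dist_le z w
    · rw [mul_assoc]
      refine mul_le_mul (hbd w) ?_ (norm_nonneg _) hB0
      refine (norm_wave_sub_le ζ z w hγ0.le hγ1).trans ?_
      gcongr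
  calc _ = ‖T ⟨chartPush Γ f, hmem.1⟩‖ := h1
    _ ≤ CT * holderNorm γ (chartPush Γ f) := hCT _ hts
    _ ≤ |CT| * (B + (CQ + B * (2 + t * R))) := by
      refine mul_le_mul (le_abs_self CT) (add_le_add hsup hhol) ?_ (abs_nonneg CT)
      exact add_nonneg (Real.iSup_nonneg fun _ => norm_nonneg _) (NNReal.coe_nonneg _)
    _ ≤ |CT| * ((CQ + B * 3 + B * R) * (1 + t)) := by
      gcongr
      have a1 : 0 ≤ (CQ : ℝ) * t := by positivity
      have a2 : 0 ≤ B * t := by positivity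
      have a3 : 0 ≤ B * R := by positivity
      nlinarith
    _ = _ := by ring

/-- The product rule for `a⁻¹ Q w`: differentiating the wave produces `-i t a`, whose factor `a`
cancels `a⁻¹`. -/
theorem yDeriv_ringInverse_mul_wave {p : Euc n₁ × Euc n₂} (η : Ω) (t : ℝ)
    {a : Euc n₁ × Euc n₂ → C(Ω, ℂ)} (ha : a p = covectorPairing Ω (yDeriv j Γ p))
    (hu : IsUnit (a p))
    (hb : DifferentiableAt ℝ (fun y => Ring.inverse (a (p.1, y)) * Q (p.1, y)) p.2)
    (hΓ : DifferentiableAt ℝ (fun y => Γ (p.1, y)) p.2) :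
    yDeriv j (fun p => Ring.inverse (a p) * Q p) p η * chartWave Γ (t • (η : Euc (n₁ + n₂))) p =
      Complex.I * t * (Q p η * chartWave Γ (t • (η : Euc (n₁ + n₂))) p) +
      yDeriv j (fun p => (Ring.inverse (a p) * Q p) η *
        chartWave Γ (t • (η : Euc (n₁ + n₂))) p) p := by
  have he := ((ContinuousMap.evalCLM ℝ η).hasFDerivAt.comp p.2 hb.hasFDerivAt)
  have h1 : yDeriv j (fun p => (Ring.inverse (a p) * Q p) η) p =
      yDeriv j (fun p => Ring.inverse (a p) * Q p) p η := DFunLike.congr_fun he.fderiv _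
  rw [yDeriv_wave_mul (q := fun p => (Ring.inverse (a p) * Q p) η) _ _ he.differentiableAt hΓ, h1]
  have h2 : (inner ℝ (yDeriv j Γ p) (t • (η : Euc (n₁ + n₂))) : ℝ) =
      ((t : ℂ) * a p η) := by
    rw [ha, covectorPairing_apply, inner_smul_right]
    push_cast
    rfl
  have h3 : Ring.inverse (a p) η * a p η = 1 := by
    have := DFunLike.congr_fun (Ring.inverse_mul_cancel (a p) hu) η
    simpa using this
  rw [h2, ContinuousMap.mul_apply]
  linear_combination (Complex.I * t * Q p η * chartWave Γ (t • (η : Euc (n₁ + n₂))) p) * h3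

/-- Repeated integration by parts along the leaves yields arbitrarily fast decay. -/
theorem IsFoliationChart.exists_decay_bound (hΓ : IsFoliationChart Γ) (hK : IsCompact K)
    (hO : IsOpen O) (hKO : K ⊆ O) (hOs : O ⊆ Γ.source)
    (hunit : ∀ p ∈ O, IsUnit (covectorPairing Ω (yDeriv j Γ p)))
    (hu : IntegrableOn u Γ.target volume)
    (hD : ∀ k, ∀ α : ℝ≥0, 0 < α → LeafDerivMemHolderDual Γ (List.replicate k j) (distOf u) α)
    {R : ℝ} (hR : ∀ η : Ω, ‖(η : Euc (n₁ + n₂))‖ ≤ R) (hR0 : 0 ≤ R) (N k : ℕ)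
    (hQ : IsLeafTest K Q) :
    ∃ C : ℝ, 0 ≤ C ∧ ∀ (η : Ω) (t : ℝ), 0 < t →
      ‖distOf u (chartPush Γ (iterYDeriv (List.replicate k j)
        fun p => Q p η * chartWave Γ (t • (η : Euc (n₁ + n₂))) p))‖ ≤ C * (1 + t) * (t ^ N)⁻¹ := by
  have hKs := hKO.trans hOs
  -- Both `k` and `Q` must be free: one term of the identity replaces `Q` by `∂_j(a⁻¹ Q)`, the other
  -- replaces `k` by `k + 1` and `Q` by `a⁻¹ Q`.
  induction N generalizing k Q with
  | zero => simpa using hΓ.exists_linear_bound hK hKs k (hD k) hR hR0 hQ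
  | succ N ih =>
    obtain ⟨O', hO', hKO', hcl, hcpt⟩ := exists_open_between_and_isCompact_closure hK hO hKO
    have hO'O : O' ⊆ O := subset_closure.trans hcl
    set a : Euc n₁ × Euc n₂ → C(Ω, ℂ) := fun p => covectorPairing Ω (yDeriv j Γ p)
    have hb : ∀ k, ∃ α : ℝ, 0 < α ∧ α ≤ 1 ∧
        HolderYDerivs α O' k fun p => Ring.inverse (a p) := fun k => by
      obtain ⟨α, h0, h1, h⟩ := hΓ.derivs.exists_holderYDerivs Γ.open_source hcpt
        (hcl.trans hOs) hO' (k + 1)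
      exact ⟨α, h0, h1, ((h.2.2 _).clm (covectorPairing Ω) hO' h0).ringInverse hO' h0
        fun p hp => hunit p (hO'O hp)⟩
    have hbQ : IsLeafTest K fun p => Ring.inverse (a p) * Q p :=
      IsLeafTest.mul_left hK.isClosed hO' hKO' hb hQ
    have hdbQ := hbQ.yDeriv hK.isClosed j
    obtain ⟨C₁, hC₁, h₁⟩ := ih k hdbQ
    obtain ⟨C₂, hC₂, h₂⟩ := ih (k + 1) hbQ
    refine ⟨C₁ + C₂, add_nonneg hC₁ hC₂, fun η t ht => ?_⟩
    specialize h₁ η t ht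
    specialize h₂ η t ht
    set ζ : Euc (n₁ + n₂) := t • (η : Euc (n₁ + n₂))
    obtain ⟨α₀, hα₀, -, -, hw₀⟩ := hΓ.exists_holderYDerivs_wave hK hKs hQ k
    obtain ⟨α₂, hα₂, -, hH₂, hw₂⟩ := hΓ.exists_holderYDerivs_wave hK hKs hbQ (k + 1)
    set α := min α₀ α₂
    have hα : 0 < α := lt_min hα₀ hα₂
    have hf₀ := (hw₀ η ζ).mono_exponent hα.le (min_le_left α₀ α₂)
    have hf₂ := (hw₂ η ζ).mono_exponent hα.le (min_le_right α₀ α₂)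
    set f₀ : Euc n₁ × Euc n₂ → ℂ := fun p => Q p η * chartWave Γ ζ p
    set f₂ : Euc n₁ × Euc n₂ → ℂ := fun p => (Ring.inverse (a p) * Q p) η * chartWave Γ ζ p
    have hf₀K : ∀ p ∉ K, f₀ p = 0 := fun p hp => by simp [f₀, hQ.2 p hp]
    have hf₂K : ∀ p ∉ K, f₂ p = 0 := fun p hp => by simp [f₂, hQ.2 p hp]
    have hstep : (fun p => yDeriv j (fun p => Ring.inverse (a p) * Q p) p η * chartWave Γ ζ p) =
        fun p => Complex.I * t * f₀ p + yDeriv j f₂ p := by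
      funext p
      by_cases hp : p ∈ K
      · obtain ⟨_, _, _, h⟩ := hΓ.derivs.exists_holderYDerivs Γ.open_source hcpt
          (hcl.trans hOs) hO' 1
        exact yDeriv_ringInverse_mul_wave η t rfl (hunit p (hKO hp)) (hH₂.2.1 p (mem_univ p))
          (h.2.1 p (hKO' hp))
      · have h2 : yDeriv j f₂ p = 0 := iterYDeriv_eq_zero hK.isClosed hf₂K [j] p hp
        rw [hdbQ.2 p hp, hf₀K p hp, h2]
        simp
    rw [hstep, iterYDeriv_linear (α := α) _ _ (by rwa [List.length_replicate])
      (by rw [List.length_replicate]; exact hf₂.2.2 _)] at h₁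
    have hcomm : iterYDeriv (List.replicate k j) (yDeriv j f₂) =
        iterYDeriv (List.replicate (k + 1) j) f₂ := by
      rw [List.replicate_succ', iterYDeriv, iterYDeriv, List.foldr_append]
      rfl
    rw [hcomm] at h₁
    have hi₀ := hΓ.integrable_mul_chartPush hK hKs hu hα
      (f := iterYDeriv (List.replicate k j) f₀)
      (fun p => (HolderYDerivs.iterYDeriv (l := 0) (List.replicate k j)
        (by rwa [List.length_replicate, Nat.zero_add]) : HolderYDerivs α univ 0 _) p (mem_univ p))
      (iterYDeriv_eq_zero hK.isClosed hf₀K _)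
    have hi₂ := hΓ.integrable_mul_chartPush hK hKs hu hα
      (f := iterYDeriv (List.replicate (k + 1) j) f₂)
      (fun p => (HolderYDerivs.iterYDeriv (l := 0) (List.replicate (k + 1) j)
        (by rwa [List.length_replicate, Nat.zero_add]) : HolderYDerivs α univ 0 _) p (mem_univ p))
      (iterYDeriv_eq_zero hK.isClosed hf₂K _)
    have hlin : distOf u (chartPush Γ fun p => Complex.I * t *
          iterYDeriv (List.replicate k j) f₀ p + iterYDeriv (List.replicate (k + 1) j) f₂ p) =
        Complex.I * t * distOf u (chartPush Γ (iterYDeriv (List.replicate k j) f₀)) +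
        distOf u (chartPush Γ (iterYDeriv (List.replicate (k + 1) j) f₂)) := by
      simp only [distOf]
      rw [← integral_const_mul, ← integral_add (hi₀.const_mul _) hi₂]
      congr 1
      funext z
      by_cases hz : z ∈ Γ.target
      · simp only [chartPush, indicator_of_mem hz]
        ring
      · simp [chartPush, indicator_of_notMem hz]
    rw [hlin] at h₁
    set X := distOf u (chartPush Γ (iterYDeriv (List.replicate k j) f₀))
    set Y := distOf u (chartPush Γ (iterYDeriv (List.replicate (k + 1) j) f₂))
    -- The left side of the identity is bounded with `C₁` and its last term with `C₂`; the remaining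
    -- term is `i t X`.
    have hX : t * ‖X‖ ≤ (C₁ + C₂) * (1 + t) * (t ^ N)⁻¹ := by
      have e1 : ‖Complex.I * t * X‖ = t * ‖X‖ := by
        rw [norm_mul, norm_mul, Complex.norm_I, one_mul, Complex.norm_real,
          Real.norm_of_nonneg ht.le]
      rw [← e1]
      have := norm_sub_le (Complex.I * t * X + Y) Y
      rw [add_sub_cancel_right] at this
      linarith
    rw [pow_succ, mul_inv, ← mul_assoc, ← div_eq_mul_inv, le_div_iff₀ ht, mul_comm]
    exact hX

end

/-! ### Localisation near the given covector and conclusion -/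

section

variable {n₁ n₂ : ℕ} {Γ : OpenPartialHomeomorph (Euc n₁ × Euc n₂) (Euc (n₁ + n₂))}

theorem IsFoliationChart.continuousAt_yDeriv (hΓ : IsFoliationChart Γ) (j : Fin n₂)
    {p : Euc n₁ × Euc n₂} (hp : p ∈ Γ.source) : ContinuousAt (yDeriv j Γ) p := by
  obtain ⟨O', hO', hpO', hcl, hcpt⟩ := exists_open_between_and_isCompact_closure
    (isCompact_singleton (x := p)) Γ.open_source (singleton_subset_iff.2 hp)
  obtain ⟨α, h0, -, h⟩ := hΓ.derivs.exists_holderYDerivs Γ.open_source hcpt hcl hO' 1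
  exact (h.2.2 _ p (hpO' rfl)).continuousAt h0

/-- A covector that does not annihilate the plaque direction is detected by some `V_j`, uniformly
for nearby points and covectors. -/
theorem IsFoliationChart.exists_transverse_nhds (hΓ : IsFoliationChart Γ)
    {p₀ : Euc n₁ × Euc n₂} (hp₀ : p₀ ∈ Γ.source) {ζ₀ : Euc (n₁ + n₂)} {v : Euc n₂}
    (hv : inner ℝ (yFDeriv Γ p₀ v) ζ₀ ≠ 0) :
    ∃ j : Fin n₂, ∃ O, IsOpen O ∧ p₀ ∈ O ∧ O ⊆ Γ.source ∧ ∃ ε > 0, ε < ‖ζ₀‖ ∧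
      ∀ p ∈ O, ∀ η ∈ Metric.closedBall ζ₀ ε, inner ℝ (yDeriv j Γ p) η ≠ 0 := by
  have hζ₀ : ζ₀ ≠ 0 := by
    rintro rfl
    simp at hv
  -- If `ζ₀` annihilated every `∂_j Γ` at `p₀`, it would by linearity annihilate the whole tangent
  -- space of the plaque.
  obtain ⟨j, hj⟩ : ∃ j, inner ℝ (yDeriv j Γ p₀) ζ₀ ≠ 0 := by
    by_contra! h
    have hL : (innerSL ℝ ζ₀ ∘L yFDeriv Γ p₀ : Euc n₂ →L[ℝ] ℝ).toLinearMap = 0 := by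
      refine (EuclideanSpace.basisFun (Fin n₂) ℝ).toBasis.ext fun j => ?_
      simpa [yDeriv, real_inner_comm] using h j
    refine hv ?_
    simpa [real_inner_comm] using LinearMap.congr_fun hL v
  have hc : ContinuousAt
      (fun q : (Euc n₁ × Euc n₂) × Euc (n₁ + n₂) => inner ℝ (yDeriv j Γ q.1) q.2) (p₀, ζ₀) :=
    ContinuousAt.inner (𝕜 := ℝ) (ContinuousAt.comp (f := Prod.fst)
      (hΓ.continuousAt_yDeriv j hp₀) continuousAt_fst) continuousAt_snd
  obtain ⟨S, hS, V, hV, hSV⟩ := Filter.mem_prod_iff.1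
    (nhds_prod_eq (x := p₀) (y := ζ₀) ▸ hc.eventually_ne hj)
  obtain ⟨ε, hε, hεV⟩ := Metric.nhds_basis_closedBall.mem_iff.1 hV
  have hn : 0 < ‖ζ₀‖ := norm_pos_iff.2 hζ₀
  -- The bound `‖ζ₀‖ / 2` keeps the origin out of the ball, so that the cone over it omits 0.
  refine ⟨j, interior S ∩ Γ.source, isOpen_interior.inter Γ.open_source,
    ⟨mem_interior_iff_mem_nhds.2 hS, hp₀⟩, inter_subset_right, min ε (‖ζ₀‖ / 2),
    lt_min hε (half_pos hn), (min_le_right _ _).trans_lt (half_lt_self hn), fun p hp η hη => ?_⟩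
  exact @hSV (p, η) ⟨interior_subset hp.1,
    hεV (Metric.closedBall_subset_closedBall (min_le_left _ _) hη)⟩

/-- A smooth cut-off, read in the chart, as a test function with constant values in `C(Ω, ℂ)`. -/
theorem IsFoliationChart.isLeafTest_cutoff (hΓ : IsFoliationChart Γ) {K : Set (Euc n₁ × Euc n₂)}
    (hK : IsCompact K) (hKs : K ⊆ Γ.source) (Ω : Set (Euc (n₁ + n₂))) [CompactSpace Ω]
    {χ : Euc (n₁ + n₂) → ℂ} (hχ : ContDiff ℝ ∞ χ)
    (hχK : ∀ p ∈ Γ.source, p ∉ K → χ (Γ p) = 0) :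
    IsLeafTest K fun p => K.indicator (fun p => χ (Γ p)) p • (1 : C(Ω, ℂ)) := by
  have hz : ∀ p ∉ K, K.indicator (fun p => χ (Γ p)) p • (1 : C(Ω, ℂ)) = 0 := fun p hp => by
    rw [indicator_of_notMem hp, zero_smul]
  refine ⟨fun k => ?_, hz⟩
  obtain ⟨O', hO', hKO', hcl, hcpt⟩ :=
    exists_open_between_and_isCompact_closure hK Γ.open_source hKs
  obtain ⟨α, h0, h1, h⟩ := hΓ.derivs.exists_holderYDerivs Γ.open_source hcpt hcl hO' k
  refine ⟨α, h0, h1, HolderYDerivs.univ_of_vanish hK.isClosed hKO' ?_ hz⟩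
  -- On `O'` the indicator changes nothing, since `χ ∘ Γ` already vanishes off `K` there; it only
  -- removes the uncontrolled values of `Γ` outside its source.
  refine ((h.comp_contDiff hχ hO' h0).clm
    ((ContinuousLinearMap.id ℝ ℂ).smulRight (1 : C(Ω, ℂ))) hO' h0).congr hO' fun p hp => ?_
  by_cases hpK : p ∈ K
  · simp [indicator_of_mem hpK]
  · simp [indicator_of_notMem hpK, hχK p (hcl (subset_closure hp)) hpK]

end

theorem mainTheorem5 (n₁ n₂ : ℕ) (M : Set (Euc (n₁ + n₂))) (F : HolderFoliation n₁ n₂ M)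
    (hF : F.IsStronglyAbsolutelyContinuous)
    (u : Euc (n₁ + n₂) → ℂ) (hu : IntegrableOn u M volume)
    (hD : ∀ Γ ∈ F.charts, ∀ I : List (Fin n₂), ∀ α : ℝ≥0, 0 < α →
      LeafDerivMemHolderDual Γ I (distOf u) α)
    (z₀ ζ₀ : Euc (n₁ + n₂)) (hz₀ : z₀ ∈ M) (hζ₀ : ζ₀ ≠ 0) (hconormal : ¬ F.IsConormal z₀ ζ₀) :
    (z₀, ζ₀) ∉ waveFrontSet M u := by
  rintro ⟨-, -, hsing⟩
  refine hsing ?_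
  simp only [HolderFoliation.IsConormal, not_forall] at hconormal
  obtain ⟨Γ, hΓF, hzΓ, v, hv⟩ := hconormal
  have hΓ := F.isChart Γ hΓF
  have hΓM : Γ.target ⊆ M := F.cover ▸ subset_biUnion_of_mem (u := fun Γ => Γ.target) hΓF
  obtain ⟨j, O, hO, hpO, hOs, ε, hε, hεζ, htrans⟩ :=
    hΓ.exists_transverse_nhds (Γ.map_target hzΓ) hv
  obtain ⟨r, hr, hrU⟩ := Metric.isOpen_iff.1 (Γ.isOpen_inter_preimage_symm hO) z₀ ⟨hzΓ, hpO⟩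
  refine ⟨Metric.ball z₀ r, Metric.isOpen_ball, Metric.mem_ball_self hr,
    fun z hz => hΓM (hrU hz).1,
    {ζ | ∃ s : ℝ, 0 < s ∧ s • ζ ∈ Metric.ball ζ₀ ε}, ?_,
    ⟨1, one_pos, by simpa using hε⟩, ?_, ?_, ?_⟩
  · have : {ζ : Euc (n₁ + n₂) | ∃ s : ℝ, 0 < s ∧ s • ζ ∈ Metric.ball ζ₀ ε} =
        ⋃ s ∈ Ioi (0 : ℝ), (fun ζ => s • ζ) ⁻¹' Metric.ball ζ₀ ε := by
      ext ζ
      simp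
    rw [this]
    exact isOpen_biUnion fun s _ => Metric.isOpen_ball.preimage (continuous_const_smul s)
  · rintro ⟨s, -, hs⟩
    rw [smul_zero, Metric.mem_ball, dist_zero_left] at hs
    exact hs.not_gt hεζ
  · rintro ζ ⟨s, hs, h⟩ t ht
    exact ⟨s * t⁻¹, by positivity, by rwa [smul_smul, mul_assoc, inv_mul_cancel₀ ht.ne', mul_one]⟩
  intro N _ χ hχ hsupp
  have hcs : IsCompact (tsupport χ) :=
    Metric.isCompact_of_isClosed_isBounded (isClosed_tsupport χ)
      (Metric.isBounded_ball.subset hsupp)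
  have hst : tsupport χ ⊆ Γ.target := fun z hz => (hrU (hsupp hz)).1
  set K := Γ.symm '' tsupport χ
  have hK : IsCompact K := hcs.image_of_continuousOn (Γ.continuousOn_symm.mono hst)
  have hKO : K ⊆ O := by
    rintro _ ⟨z, hz, rfl⟩
    exact (hrU (hsupp hz)).2
  have hmemK : ∀ {z}, z ∈ Γ.target → Γ.symm z ∈ K → z ∈ tsupport χ := by
    rintro z hz ⟨w, hw, hwz⟩
    rwa [← Γ.symm.injOn (hst hw) hz hwz]
  set Ω := Metric.closedBall ζ₀ ε
  have : CompactSpace Ω := isCompact_iff_compactSpace.1 (isCompact_closedBall ζ₀ ε)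
  have hQ := hΓ.isLeafTest_cutoff hK (hKO.trans hOs) Ω hχ fun p hp hpK => by
    by_contra h
    exact hpK ⟨Γ p, subset_tsupport χ h, Γ.left_inv hp⟩
  have hR : ∀ η : Ω, ‖(η : Euc (n₁ + n₂))‖ ≤ ‖ζ₀‖ + ε := fun η => by
    have h1 := norm_le_norm_add_norm_sub ζ₀ (η : Euc (n₁ + n₂))
    have h2 : dist (η : Euc (n₁ + n₂)) ζ₀ ≤ ε := η.2
    rw [dist_comm, dist_eq_norm] at h2
    linarith
  have hunit : ∀ p ∈ O, IsUnit (covectorPairing Ω (yDeriv j Γ p)) := fun p hp => by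
    rw [ContinuousMap.isUnit_iff_forall_ne_zero]
    intro η
    rw [covectorPairing_apply]
    exact_mod_cast htrans p hp η η.2
  set R := ‖ζ₀‖ + ε
  have hR0 : 0 ≤ R := by positivity
  -- One step more than `N`, to absorb the factor `1 + t` of the crude bound.
  obtain ⟨C, hC0, hC⟩ := hΓ.exists_decay_bound hK hO hKO hOs hunit (hu.mono_set hΓM)
    (fun k => hD Γ hΓF _) hR hR0 (N + 1) 0 hQ
  refine ⟨C * (R + 1) * R ^ N, ?_⟩
  rintro ζ ⟨s, hs, hsζ⟩ hζ
  have hη : s • ζ ∈ Ω := Metric.ball_subset_closedBall hsζ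
  -- Here `ζ = t • η` with `η = s • ζ` in the ball and `t = s⁻¹`. As `s ‖ζ‖ ≤ R` and `‖ζ‖ > 1`, the
  -- bound `C (s + 1) s ^ N` is at most `C (R + 1) (R / ‖ζ‖) ^ N`.
  have hb := hC ⟨s • ζ, hη⟩ s⁻¹ (inv_pos.2 hs)
  simp only [smul_smul, inv_mul_cancel₀ hs.ne', one_smul] at hb
  have hint : distOf u (chartPush Γ (iterYDeriv (List.replicate 0 j) fun p =>
      (K.indicator (fun p => χ (Γ p)) p • (1 : C(Ω, ℂ))) ⟨s • ζ, hη⟩ * chartWave Γ ζ p)) =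
      ∫ z, u z * χ z * Complex.exp (-Complex.I * (inner ℝ z ζ : ℝ)) := by
    refine integral_congr_ae (Filter.Eventually.of_forall fun z => ?_)
    change u z * chartPush Γ (fun p => (K.indicator (fun p => χ (Γ p)) p • (1 : C(Ω, ℂ)))
      ⟨s • ζ, hη⟩ * chartWave Γ ζ p) z = u z * χ z * _
    rw [chartPush_wave (Q := fun p => K.indicator (fun p => χ (Γ p)) p • (1 : C(Ω, ℂ))), mul_assoc]
    congr 2
    by_cases hz : z ∈ tsupport χ
    · have hzK : Γ.symm z ∈ K := mem_image_of_mem _ hz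
      simp [chartPush, indicator_of_mem (hst hz), indicator_of_mem hzK, Γ.right_inv (hst hz)]
    · rw [image_eq_zero_of_notMem_tsupport hz]
      by_cases hzt : z ∈ Γ.target
      · have hzK : Γ.symm z ∉ K := fun h => hz (hmemK hzt h)
        simp [chartPush, indicator_of_mem hzt, indicator_of_notMem hzK]
      · simp [chartPush, indicator_of_notMem hzt]
  rw [← hint]
  refine hb.trans ?_
  have hsR : s * ‖ζ‖ ≤ R := by
    have := hR ⟨s • ζ, hη⟩
    rwa [norm_smul, Real.norm_of_nonneg hs.le] at this
  have hs' : s ≤ R := by nlinarith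
  have hζ0 : 0 < ‖ζ‖ := by linarith
  have e1 : C * (1 + s⁻¹) * (s⁻¹ ^ (N + 1))⁻¹ = C * ((s + 1) * s ^ N) := by
    rw [inv_pow, inv_inv, pow_succ]
    field_simp
  rw [e1, mul_assoc C, mul_assoc C, ← div_eq_mul_inv, mul_div_assoc, ← div_pow]
  gcongr
  rwa [le_div_iff₀ hζ0]
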